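/- Let $n\ge 1$, $\sigma_x,\sigma_w>0$, $\Omega=\sigma_x^2/\sigma_w^2$, $\sigma_y^2=\sigma_x^2+\sigma_w^2$, and let $x\in\mathbb R^n$ satisfy $\|x\|^2=n\sigma_x^2$. Let $p(\cdot|x)$ and $q$ be the densities of $\mathcal N(x,\sigma_w^2 I_n)$ and $\mathcal N(0,\sigma_y^2 I_n)$, let $\Lambda(y)=\frac1n\ln\frac{p(y|x)}{q(y)}$, and for a threshold $\lambda\in\mathbb R$ let $$P_{MD}(\lambda)=\mathrm P[\Lambda(y)<\lambda\mid y\sim p(\cdot|x)],\qquad P_{FA}(\lambda)=\mathrm P[\Lambda(y)\ge\lambda\mid y\sim q]$$ be the missed-detection and false-alarm probabilities of the Neyman-Pearson test. Parametrize thresholds by $\gamma>0$ through $2\lambda=1+\ln(1+\Omega)-\frac{\Omega}{1+\Omega}\lambda'$ and $\lambda'=\frac{\Omega}{4\sinh^2\gamma}$. Put $\theta_{MD}=\ln\frac{\Omega}{2\sinh\gamma}$ and $\theta_{FA}=\theta_{MD}-\ln(1+\Omega)$. Let $\alpha(z)=\cosh\gamma-\cosh z+(z-\gamma)\sinh\gamma$,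 and let $t$ be the function analytic near $0$ with $t(0)=e^\gamma$, $2\alpha(\ln t(u))=u^2$ and $\Im t'(0)>0$. For $\theta\in\{\theta_{MD},\theta_{FA}\}$ let $v=-\alpha(\theta)/\sinh\gamma$, let $\frac{t'(u)}{e^\theta-t(u)}=i\sum_{k\ge0}c_ku^k$ be the Taylor expansion at $0$, and for $K\ge 1$ let $$g^{(K)}=\frac1{2\sqrt\pi}\sum_{k=0}^{K-1}c_{2k}\frac{\Gamma(k+\frac12)}{\Gamma(\frac12)}\Big(\frac{4\sinh\gamma}{n}\Big)^{k+\frac12}.$$ The $K$-term asymptotic expansions of the two probabilities are $$P_{MD}^{(K)}=1(\operatorname{sign}(\gamma-\theta_{MD}))+g_{MD}^{(K)}e^{-\frac n2v_{MD}},\qquad P_{FA}^{(K)}=1(-\operatorname{sign}(\gamma-\theta_{FA}))-g_{FA}^{(K)}e^{-\frac n2v_{FA}},$$ where $1(s)=1$ for $s\ge0$ and $1(s)=0$ for $s<0$, and subscripts indicate the value of $\theta$ that is used. **Theorem.** For every $\gamma$ with $$\tfrac12\ln\Big(1+\frac{\Omega}{1+\Omega}\Big)<\gamma<\tfrac12\ln(1+\Omega)\qquad(*)$$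 one has $P_{MD}\le P_{MD}^{(1)}$ and $P_{FA}\le P_{FA}^{(1)}$. Consequently: (i) for $0<P_e<1$, if $\overline R=-\frac1n\log_2P_{FA}(\lambda)$ with $\lambda$ set by $P_{MD}(\lambda)=P_e$, and $\overline R^{(1)}=-\frac1n\log_2P_{FA}^{(1)}(\gamma)$ with $\gamma$ satisfying $(*)$ and $P_{MD}^{(1)}(\gamma)=P_e$, then $\overline R^{(1)}\le\overline R$; (ii) for $R>0$, if $\underline P_e=P_{MD}(\lambda)$ with $\lambda$ set by $-\frac1n\log_2P_{FA}(\lambda)=R$, and $\underline P_e^{(1)}=P_{MD}^{(1)}(\gamma)$ with $\gamma$ satisfying $(*)$ and $-\frac1n\log_2P_{FA}^{(1)}(\gamma)=R$, then $\underline P_e\le\underline P_e^{(1)}$. -/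

import Mathlib

open MeasureTheory ProbabilityTheory Filter Topology

namespace AWGN

/-! ### The channel and the Neyman-Pearson test -/

/-- Law on `ℝⁿ` of a Gaussian vector with mean `a` and covariance `v • I`. -/
noncomputable def gaussianLaw {n : ℕ} (a : Fin n → ℝ) (v : NNReal) : Measure (Fin n → ℝ) :=
  Measure.pi fun i => gaussianReal (a i) v

/-- Density of `gaussianLaw a v` at `b`, a product of one-dimensional normal densities. -/
noncomputable def gaussianDensity {n : ℕ} (a : Fin n → ℝ) (v : NNReal) (b : Fin n → ℝ) : ℝ :=
  ∏ i, gaussianPDFReal (a i) v (b i)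

/-- The signal-to-noise ratio `Ω = σx² / σw²`. -/
noncomputable def snr (σx σw : ℝ) : ℝ := σx ^ 2 / σw ^ 2

/-- The noise variance `σw²`. -/
noncomputable def noiseVar (σw : ℝ) : NNReal := (σw ^ 2).toNNReal

/-- The received-signal variance `σy² = σx² + σw²`. -/
noncomputable def outputVar (σx σw : ℝ) : NNReal := (σx ^ 2 + σw ^ 2).toNNReal

/-- Normalized log-likelihood ratio `Λ(x, y) = (1/n) ln (p(y|x) / q(y))`, where `p(·|x)` is
the density of `N(x, σw² I)` and `q` is the density of `N(0, σy² I)`. -/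
noncomputable def logLikelihood {n : ℕ} (σx σw : ℝ) (x y : Fin n → ℝ) : ℝ :=
  1 / (n : ℝ) *
    Real.log (gaussianDensity x (noiseVar σw) y / gaussianDensity 0 (outputVar σx σw) y)

/-- Missed-detection probability of the Neyman-Pearson test with threshold `lam`:
the probability of `Λ(x, y) < lam` when `y ~ N(x, σw² I)`. -/
noncomputable def pMD {n : ℕ} (σx σw : ℝ) (x : Fin n → ℝ) (lam : ℝ) : ℝ :=
  (gaussianLaw x (noiseVar σw)).real {y | logLikelihood σx σw x y < lam}

/-- False-alarm probability of the Neyman-Pearson test with threshold `lam`: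
the probability of `lam ≤ Λ(x, y)` when `y ~ N(0, σy² I)`. -/
noncomputable def pFA {n : ℕ} (σx σw : ℝ) (x : Fin n → ℝ) (lam : ℝ) : ℝ :=
  (gaussianLaw (0 : Fin n → ℝ) (outputVar σx σw)).real {y | lam ≤ logLikelihood σx σw x y}

/-- The threshold `λ` that corresponds to the parameter `γ > 0`, through
`2 λ = 1 + ln (1 + Ω) - Ω / (1 + Ω) * λ'` and `λ' = Ω / (4 sinh² γ)`. -/
noncomputable def threshold (Ω γ : ℝ) : ℝ :=
  (1 + Real.log (1 + Ω) - Ω / (1 + Ω) * (Ω / (4 * Real.sinh γ ^ 2))) / 2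

/-- The rate `-(1/n) log₂ p`. -/
noncomputable def rate (n : ℕ) (p : ℝ) : ℝ := -(1 / (n : ℝ)) * Real.logb 2 p

/-! ### The asymptotic expansion -/

/-- `α(z) = cosh γ - cosh z + sinh γ * (z - γ)`. -/
noncomputable def alpha (γ : ℝ) (z : ℂ) : ℂ :=
  Complex.cosh γ - Complex.cosh z + Complex.sinh γ * (z - γ)

/-- `t` is the analytic function near `0` with `t 0 = e ^ γ` which inverts
`x ↦ √(2 α(ln x))`; of the two such functions (they differ by `u ↦ -u`), the one for which
the upper half-plane corresponds to positive `u`. -/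
def IsSaddleMap (γ : ℝ) (t : ℂ → ℂ) : Prop :=
  AnalyticAt ℂ t 0 ∧ t 0 = Complex.exp γ ∧ 0 < (deriv t 0).im ∧
    ∀ᶠ u in 𝓝 0, u ^ 2 = 2 * alpha γ (Complex.log (t u))

theorem exists_isSaddleMap (γ : ℝ) : ∃ t, IsSaddleMap γ t := by
  set A : ℂ → ℂ := fun w => 2 * alpha γ w with hA
  have hdA : ∀ w, HasDerivAt A (2 * (Complex.sinh γ - Complex.sinh w)) w := by
    intro w
    have h := (((Complex.hasDerivAt_cosh w).const_sub (Complex.cosh γ)).add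
      (((hasDerivAt_id w).sub_const (γ : ℂ)).const_mul (Complex.sinh γ))).const_mul 2
    refine h.congr_deriv ?_
    ring
  have hA0 : A γ = 0 := by simp [hA, alpha]
  have hA1 : deriv A γ = 0 := by rw [(hdA γ).deriv]; simp
  have hdiff : Differentiable ℂ A := fun w => (hdA w).differentiableAt
  have hslope : ∀ F : ℂ → ℂ, Differentiable ℂ F → Differentiable ℂ (dslope F γ) := by
    intro F hF
    rw [← differentiableOn_univ]
    exact (Complex.differentiableOn_dslope univ_mem).2 hF.differentiableOn
  set h : ℂ → ℂ := dslope (dslope A γ) γ with hh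
  have hhd : Differentiable ℂ h := hslope _ (hslope _ hdiff)
  have hfac : ∀ w, A w = (w - γ) ^ 2 * h w := by
    intro w
    have e1 := sub_smul_dslope A (γ : ℂ) w
    have e2 := sub_smul_dslope (dslope A γ) (γ : ℂ) w
    rw [dslope_same, hA1, sub_zero] at e2
    rw [hA0, sub_zero] at e1
    rw [← e1, ← e2]
    simp only [smul_eq_mul]
    ring
  have hh0 : h γ = -Complex.cosh γ := by
    have hder : ∀ w, 2 * (Complex.sinh γ - Complex.sinh w)
        = (w - γ) * (2 * h w + (w - γ) * deriv h w) := by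
      intro w
      have h1 := ((((hasDerivAt_id w).sub_const (γ : ℂ)).pow 2).mul (hhd w).hasDerivAt)
      have h2 : HasDerivAt A _ w := h1.congr_of_eventuallyEq (Eventually.of_forall hfac)
      rw [(hdA w).unique h2]
      simp
      ring
    have hcd : DifferentiableAt ℂ (deriv h) γ :=
      (hhd.analyticAt (γ : ℂ)).deriv.differentiableAt
    have hl : HasDerivAt (fun w : ℂ => 2 * (Complex.sinh γ - Complex.sinh w))
        (2 * (-Complex.cosh γ)) γ :=
      ((Complex.hasDerivAt_sinh _).const_sub _).const_mul 2
    have hid : HasDerivAt (fun w : ℂ => w - γ) 1 (γ : ℂ) :=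
      (hasDerivAt_id (γ : ℂ)).sub_const (γ : ℂ)
    have hr := hid.mul
      (((hhd (γ : ℂ)).hasDerivAt.const_mul 2).add (hid.mul hcd.hasDerivAt))
    have hl2 := hr.congr_of_eventuallyEq (f₁ := fun w : ℂ => 2 * (Complex.sinh γ - Complex.sinh w))
      (Eventually.of_forall hder)
    have := hl.unique hl2
    simp at this
    linear_combination -(1 / 2 : ℂ) * this
  have hcpos : 0 < Real.cosh γ := Real.cosh_pos γ
  -- analytic square root of `A`
  set S : ℂ → ℂ := fun w => (w - γ) * (-Complex.I * Complex.exp (Complex.log (-h w) / 2)) with hS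
  have hneg : -h γ = (Real.cosh γ : ℂ) := by rw [hh0]; simp
  have hhan : AnalyticAt ℂ h γ := hhd.analyticAt _
  have hroot : AnalyticAt ℂ (fun w => -Complex.I * Complex.exp (Complex.log (-h w) / 2)) γ := by
    refine analyticAt_const.mul (AnalyticAt.cexp ((hhan.neg.clog ?_).div_const))
    show -h γ ∈ Complex.slitPlane
    rw [hneg]
    exact Complex.ofReal_mem_slitPlane.2 hcpos
  have hSan : AnalyticAt ℂ S γ := (analyticAt_id.sub analyticAt_const).mul hroot
  have hS0 : S γ = 0 := by simp [hS]
  have hSsq : ∀ᶠ w in 𝓝 (γ : ℂ), S w ^ 2 = A w := by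
    have hne : ∀ᶠ w in 𝓝 (γ : ℂ), -h w ≠ 0 := by
      refine hhan.continuousAt.neg.eventually_ne ?_
      show -h γ ≠ 0
      rw [hneg]
      exact_mod_cast hcpos.ne'
    filter_upwards [hne] with w hw
    have e : Complex.exp (Complex.log (-h w) / 2) ^ 2 = -h w := by
      rw [← Complex.exp_nat_mul]
      rw [show ((2 : ℕ) : ℂ) * (Complex.log (-h w) / 2) = Complex.log (-h w) by push_cast; ring]
      exact Complex.exp_log hw
    rw [hfac w, hS]
    simp only [mul_pow, e, neg_sq, Complex.I_sq]
    ring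
  set r : ℝ := Real.exp (Real.log (Real.cosh γ) / 2) with hr
  have hr0 : 0 < r := Real.exp_pos _
  have hderS : deriv S γ = -Complex.I * r := by
    have hid : HasDerivAt (fun w : ℂ => w - γ) 1 (γ : ℂ) :=
      (hasDerivAt_id (γ : ℂ)).sub_const (γ : ℂ)
    have h1 := (hid.mul hroot.differentiableAt.hasDerivAt).deriv
    have h2 : deriv S γ = -Complex.I * Complex.exp (Complex.log (-h γ) / 2) := by
      refine h1.trans ?_
      simp
    rw [h2, hneg, ← Complex.ofReal_log hcpos.le, hr]
    push_cast
    ring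
  have hderne : deriv S γ ≠ 0 := by
    rw [hderS]
    exact mul_ne_zero (neg_ne_zero.2 Complex.I_ne_zero) (by exact_mod_cast hr0.ne')
  set W : ℂ → ℂ := hSan.hasStrictDerivAt.localInverse _ _ _ hderne with hW
  have hWan : AnalyticAt ℂ W 0 := by
    have := hSan.analyticAt_localInverse hderne
    rwa [hS0] at this
  have hW0 : W 0 = γ := by
    have : W (S γ) = γ := HasStrictFDerivAt.localInverse_apply_image ..
    rwa [hS0] at this
  have hWinv : ∀ᶠ u in 𝓝 (0 : ℂ), S (W u) = u := by
    have := HasStrictDerivAt.eventually_right_inverse hSan.hasStrictDerivAt hderne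
    rwa [hS0] at this
  have hWd : HasDerivAt W (deriv S γ)⁻¹ 0 := by
    have := (hSan.hasStrictDerivAt.to_localInverse hderne).hasDerivAt
    rwa [hS0] at this
  refine ⟨fun u => Complex.exp (W u), hWan.cexp, by simp only [hW0], ?_, ?_⟩
  · have hd := hWd.cexp.deriv
    rw [hW0, hderS] at hd
    rw [hd]
    have e : Complex.exp γ * (-Complex.I * (r : ℂ))⁻¹
        = ((Real.exp γ / r : ℝ) : ℂ) * Complex.I := by
      have : (r : ℂ) ≠ 0 := by exact_mod_cast hr0.ne'
      push_cast
      field_simp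
      simp
    rw [e, Complex.im_ofReal_mul, Complex.I_im, mul_one]
    positivity
  · have hcont : Tendsto W (𝓝 0) (𝓝 (γ : ℂ)) := by
      have := hWan.continuousAt.tendsto
      rwa [hW0] at this
    have him : ∀ᶠ u in 𝓝 (0 : ℂ), (W u).im ∈ Set.Ioo (-Real.pi) Real.pi := by
      refine (Complex.continuous_im.continuousAt.tendsto.comp hcont).eventually_mem ?_
      refine Ioo_mem_nhds ?_ ?_ <;> simp [Real.pi_pos]
    filter_upwards [hWinv, hcont.eventually hSsq, him] with u h1 h2 h3
    rw [Complex.log_exp h3.1 h3.2.le, ← h1, h2, h1]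

/-- The map `t` of the saddle-point parametrization. -/
noncomputable def saddleMap (γ : ℝ) : ℂ → ℂ := (exists_isSaddleMap γ).choose

/-- `f(u) = t'(u) / (e ^ θ - t(u))`. -/
noncomputable def integrand (γ θ : ℝ) (u : ℂ) : ℂ :=
  deriv (saddleMap γ) u / (Complex.exp θ - saddleMap γ u)

/-- The coefficients `c_k` in the Taylor expansion `f(u) = i ∑ c_k u ^ k` at `u = 0`
(they are used for even `k` only, and those are real). -/
noncomputable def coeff (γ θ : ℝ) (k : ℕ) : ℝ :=
  (iteratedDeriv k (integrand γ θ) 0 / (k.factorial : ℂ) / Complex.I).re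

/-- The first `K` terms of the asymptotic expansion of the function `g`. -/
noncomputable def gTrunc (n : ℕ) (γ θ : ℝ) (K : ℕ) : ℝ :=
  1 / (2 * Real.sqrt Real.pi) * ∑ k ∈ Finset.range K,
    coeff γ θ (2 * k) * (Real.Gamma (k + 1 / 2) / Real.Gamma (1 / 2)) *
      (4 * Real.sinh γ / n) ^ ((k : ℝ) + 1 / 2)

/-- The exponent `v = -α(θ) / sinh γ`. -/
noncomputable def expo (γ θ : ℝ) : ℝ := -(alpha γ θ).re / Real.sinh γ

/-- The unit step function, equal to `1` at `0`. -/
noncomputable def step (x : ℝ) : ℝ := if 0 ≤ x then 1 else 0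

/-- The value of `θ` for missed detection. -/
noncomputable def thetaMD (Ω γ : ℝ) : ℝ := Real.log (Ω / (2 * Real.sinh γ))

/-- The value of `θ` for false alarm. -/
noncomputable def thetaFA (Ω γ : ℝ) : ℝ :=
  Real.log (Ω / (2 * Real.sinh γ)) - Real.log (1 + Ω)

/-- The `K`-term expansion of the missed-detection probability. -/
noncomputable def pMDTrunc (n : ℕ) (Ω : ℝ) (K : ℕ) (γ : ℝ) : ℝ :=
  step (Real.sign (γ - thetaMD Ω γ)) +
    gTrunc n γ (thetaMD Ω γ) K * Real.exp (-(1 / 2) * n * expo γ (thetaMD Ω γ))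

/-- The `K`-term expansion of the false-alarm probability. -/
noncomputable def pFATrunc (n : ℕ) (Ω : ℝ) (K : ℕ) (γ : ℝ) : ℝ :=
  step (-Real.sign (γ - thetaFA Ω γ)) -
    gTrunc n γ (thetaFA Ω γ) K * Real.exp (-(1 / 2) * n * expo γ (thetaFA Ω γ))

/-- The range of `γ` in which both step functions vanish. -/
def Admissible (Ω γ : ℝ) : Prop :=
  1 / 2 * Real.log (1 + Ω / (1 + Ω)) < γ ∧ γ < 1 / 2 * Real.log (1 + Ω)

/-! ### Bounds on rate and error probability -/

/-- `R` is the converse rate bound at error probability `Pe`: `R = -(1/n) log₂ P_FA(λ)`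
where `λ` is set by `P_MD(λ) = Pe`. -/
def IsRateBound {n : ℕ} (σx σw : ℝ) (x : Fin n → ℝ) (Pe R : ℝ) : Prop :=
  ∃ lam : ℝ, pMD σx σw x lam = Pe ∧ R = rate n (pFA σx σw x lam)

/-- `P` is the converse error-probability bound at rate `R`: `P = P_MD(λ)` where `λ` is set
by `-(1/n) log₂ P_FA(λ) = R`. -/
def IsErrorBound {n : ℕ} (σx σw : ℝ) (x : Fin n → ℝ) (R P : ℝ) : Prop :=
  ∃ lam : ℝ, rate n (pFA σx σw x lam) = R ∧ P = pMD σx σw x lam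

/-- `R` is the `K`-term approximation of the rate bound at error probability `Pe`. -/
def IsRateTrunc (n : ℕ) (Ω : ℝ) (K : ℕ) (Pe R : ℝ) : Prop :=
  ∃ γ : ℝ, Admissible Ω γ ∧ pMDTrunc n Ω K γ = Pe ∧ R = rate n (pFATrunc n Ω K γ)

/-- `P` is the `K`-term approximation of the error-probability bound at rate `R`. -/
def IsErrorTrunc (n : ℕ) (Ω : ℝ) (K : ℕ) (R P : ℝ) : Prop :=
  ∃ γ : ℝ, Admissible Ω γ ∧ rate n (pFATrunc n Ω K γ) = R ∧ P = pMDTrunc n Ω K γ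

end AWGN

/-! Completing the square makes `Λ` a decreasing affine function of the squared distance from `y` to
a fixed multiple of `x`. Half of that distance, normalized by the variance, is noncentral
chi-squared under either hypothesis. So `P_MD` is an upper tail and `P_FA` a lower tail of a density
`p_m(y) = e^(-y-κ) y^(m-1) F_m(κy)` with `m = n/2`, where `F_m = hyp01 m` is a Bessel-type series.
Let `y₀` be the end point of the tail and let `b ≥ 0` solve `b (b + m) = κ y₀`. The one-term
expansion is then the saddle-point value of the density at `y₀` times the sum of a geometric series.
Two inequalities, valid for every `n`, show that it is an upper bound.

The local one is `hypRatio_le_one`: `F_m(b(b+m))` is at most its leading asymptotic term. Their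
ratio is at most `1` at `b = 0` by Stirling, and its derivative changes sign at most once, from
negative to positive. If the ratio ever exceeded `1`, it would stay at or above some `C > 1` from
there on. But for large noncentrality the square root of the variable, centred, has a nearly
Gaussian density, and a factor `C > 1` would contradict total mass one (Fatou).

The tail ones, `ncMeasure_real_Ioi_le` and `ncMeasure_real_Iic_le`, dominate the tails by geometric
series. Both rest on the Amos-type inequality `hyp01_amos`, which controls `F_(m+1)/F_m`.

With `b = m e^(-γ)/(2 sinh γ)`, `y₀ = m e^θ/(2 sinh γ)`, `κ = m e^(-θ)/(2 sinh γ)` the bounds become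
literally `g e^(-nv/2)`, once `c_0` is computed from `t'(0)`. The range of `γ` says `θ_FA < γ <
θ_MD`, so each tail is cut on the proper side of the saddle. Claims (i) and (ii) follow because both
probabilities are monotone in the threshold, in opposite directions. -/

namespace AWGN

/-! ### The regularized confluent hypergeometric limit function -/

/-- The regularized hypergeometric function `₀F₁(; m; w) / Γ(m)`, i.e. the modified Bessel
function `I_{m-1}(2 √w)` without its power prefactor. -/
noncomputable def hyp01 (m w : ℝ) : ℝ := ∑' j : ℕ, w ^ j / (j.factorial * Real.Gamma (m + j))

/-- From argument `1` on, a unit step multiplies Gamma by at least `1`, so only `j = 0, 1` compete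
for the minimum. The uniform bound lets the exponential series dominate `hyp01` and its derivative.
-/
theorem exists_le_Gamma_add_nat {m : ℝ} (hm : 0 < m) :
    ∃ c : ℝ, 0 < c ∧ ∀ j : ℕ, c ≤ Real.Gamma (m + j) := by
  refine ⟨min (Real.Gamma m) (Real.Gamma (m + 1)),
    lt_min (Real.Gamma_pos_of_pos hm) (Real.Gamma_pos_of_pos (by linarith)), fun j => ?_⟩
  rcases j with _ | j
  · simp
  · induction j with
    | zero => simp
    | succ k ih =>
      refine ih.trans ?_
      have hk : (0 : ℝ) ≤ k := Nat.cast_nonneg k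
      have e : m + ((k + 1 + 1 : ℕ) : ℝ) = (m + ((k + 1 : ℕ) : ℝ)) + 1 := by push_cast; ring
      rw [e, Real.Gamma_add_one (by push_cast; positivity)]
      have h1 : (1 : ℝ) ≤ m + ((k + 1 : ℕ) : ℝ) := by push_cast; linarith
      have h2 : 0 < Real.Gamma (m + ((k + 1 : ℕ) : ℝ)) :=
        Real.Gamma_pos_of_pos (by linarith)
      nlinarith

theorem summable_hyp01 {m : ℝ} (hm : 0 < m) (w : ℝ) :
    Summable fun j : ℕ => w ^ j / (j.factorial * Real.Gamma (m + j)) := by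
  obtain ⟨c, hc, h⟩ := exists_le_Gamma_add_nat hm
  refine Summable.of_norm_bounded ((Real.summable_pow_div_factorial |w|).div_const c) fun j => ?_
  have hj : (0 : ℝ) < j.factorial := by exact_mod_cast j.factorial_pos
  have hG : 0 < Real.Gamma (m + j) := hc.trans_le (h j)
  rw [Real.norm_eq_abs, abs_div, abs_pow, abs_of_pos (mul_pos hj hG), div_div]
  exact div_le_div_of_nonneg_left (by positivity) (by positivity)
    (mul_le_mul_of_nonneg_left (h j) hj.le)

theorem hyp01_zero (m : ℝ) : hyp01 m 0 = (Real.Gamma m)⁻¹ := by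
  rw [hyp01, tsum_eq_single 0]
  · simp
  · intro j hj
    simp [hj]

theorem hyp01_pos {m : ℝ} (hm : 0 < m) {w : ℝ} (hw : 0 ≤ w) : 0 < hyp01 m w := by
  have hG : ∀ j : ℕ, 0 < Real.Gamma (m + j) := fun j => Real.Gamma_pos_of_pos (by positivity)
  refine (summable_hyp01 hm w).tsum_pos (fun j => ?_) 0 ?_
  · have := hG j
    positivity
  · have := hG 0
    simp only [pow_zero, Nat.factorial_zero]
    positivity

theorem hasDerivAt_hyp01 {m : ℝ} (hm : 0 < m) (w : ℝ) :
    HasDerivAt (hyp01 m) (hyp01 (m + 1) w) w := by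
  obtain ⟨c, hc, h⟩ := exists_le_Gamma_add_nat hm
  set R : ℝ := |w| + 1 with hR
  have hR0 : 0 < R := by positivity
  have hu : Summable fun j : ℕ => (j : ℝ) * R ^ (j - 1) / (j.factorial * c) := by
    rw [← summable_nat_add_iff 1]
    refine ((Real.summable_pow_div_factorial R).div_const c).congr fun j => ?_
    rw [Nat.factorial_succ]
    have : (0 : ℝ) < j.factorial := by exact_mod_cast j.factorial_pos
    push_cast
    field_simp
  have key := hasDerivAt_tsum_of_isPreconnected (t := Metric.ball (0 : ℝ) R) (y := w) (y₀ := w)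
    (g := fun (j : ℕ) w => w ^ j / (j.factorial * Real.Gamma (m + j)))
    (g' := fun (j : ℕ) w => (j * w ^ (j - 1)) / (j.factorial * Real.Gamma (m + j)))
    hu Metric.isOpen_ball (convex_ball _ _).isPreconnected
    (fun j y _ => (hasDerivAt_pow j y).div_const _) ?_ (by simp [hR]) (summable_hyp01 hm w)
    (by simp [hR])
  · refine key.congr_deriv ?_
    rw [Summable.tsum_eq_zero_add]
    · simp only [CharP.cast_eq_zero, zero_mul, zero_div, zero_add, hyp01]
      refine tsum_congr fun j => ?_
      rw [Nat.factorial_succ]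
      have : (0 : ℝ) < j.factorial := by exact_mod_cast j.factorial_pos
      push_cast
      rw [show m + ((j : ℝ) + 1) = m + 1 + j by ring, mul_assoc, mul_div_mul_left _ _ (by positivity)]
    · rw [← summable_nat_add_iff 1]
      refine (summable_hyp01 (m := m + 1) (by linarith) w).congr fun j => ?_
      rw [Nat.factorial_succ]
      have : (0 : ℝ) < j.factorial := by exact_mod_cast j.factorial_pos
      push_cast
      rw [show m + ((j : ℝ) + 1) = m + 1 + j by ring, mul_assoc, mul_div_mul_left _ _ (by positivity)]
  · intro j y hy
    have hj : (0 : ℝ) < j.factorial := by exact_mod_cast j.factorial_pos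
    have hG : 0 < Real.Gamma (m + j) := hc.trans_le (h j)
    have hy' : |y| ≤ R := by simpa using (mem_ball_zero_iff.1 hy).le
    rw [Real.norm_eq_abs, abs_div, abs_mul, abs_pow, abs_of_pos (mul_pos hj hG), Nat.abs_cast]
    exact div_le_div₀ (by positivity)
      (mul_le_mul_of_nonneg_left (pow_le_pow_left₀ (abs_nonneg _) hy' _) (Nat.cast_nonneg _))
      (by positivity) (mul_le_mul_of_nonneg_left (h j) hj.le)

/-- Write `1/Γ(m+j) = (m+j)/Γ(m+1+j)` and split `m + j`; in the second part `j` cancels into `j!`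
and shifts the index. -/
theorem hyp01_recurrence {m : ℝ} (hm : 0 < m) (w : ℝ) :
    hyp01 m w = m * hyp01 (m + 1) w + w * hyp01 (m + 2) w := by
  have hs1 : Summable fun j : ℕ => m * (w ^ j / (j.factorial * Real.Gamma (m + 1 + j))) :=
    (summable_hyp01 (m := m + 1) (by linarith) w).mul_left m
  have hG : ∀ j : ℕ, Real.Gamma (m + 1 + j) = (m + j) * Real.Gamma (m + j) := fun j => by
    rw [show m + 1 + (j : ℝ) = m + j + 1 by ring, Real.Gamma_add_one (by positivity)]
  have hGp : ∀ j : ℕ, 0 < Real.Gamma (m + j) := fun j => Real.Gamma_pos_of_pos (by positivity)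
  have hs2 : Summable fun j : ℕ => (j : ℝ) * w ^ j / (j.factorial * Real.Gamma (m + 1 + j)) := by
    refine ((summable_hyp01 hm w).sub hs1).congr fun j => ?_
    have : (0 : ℝ) < j.factorial := by exact_mod_cast j.factorial_pos
    have := hGp j
    have : 0 < m + j := by positivity
    rw [hG]
    field_simp
    ring
  have e2 : w * hyp01 (m + 2) w
      = ∑' j : ℕ, (j : ℝ) * w ^ j / (j.factorial * Real.Gamma (m + 1 + j)) := by
    rw [hs2.tsum_eq_zero_add, hyp01, ← tsum_mul_left]
    simp only [CharP.cast_eq_zero, zero_mul, zero_div, zero_add]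
    refine tsum_congr fun j => ?_
    rw [Nat.factorial_succ]
    have : (0 : ℝ) < j.factorial := by exact_mod_cast j.factorial_pos
    have := hGp (j + 2)
    push_cast at this ⊢
    rw [show m + 1 + ((j : ℝ) + 1) = m + (j + 2) by ring, show m + 2 + (j : ℝ) = m + (j + 2) by ring,
      pow_succ]
    field_simp
  rw [e2, hyp01, hyp01, ← tsum_mul_left, ← hs1.tsum_add hs2]
  refine tsum_congr fun j => ?_
  have : (0 : ℝ) < j.factorial := by exact_mod_cast j.factorial_pos
  have := hGp j
  have : 0 < m + j := by positivity
  rw [hG]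
  field_simp

theorem continuous_hyp01 {m : ℝ} (hm : 0 < m) : Continuous (hyp01 m) :=
  continuous_iff_continuousAt.2 fun w => (hasDerivAt_hyp01 hm w).continuousAt

/-- Amos-type inequality between contiguous functions. -/
theorem hyp01_amos {m : ℝ} (hm : 1 / 2 ≤ m) {w : ℝ} (hw : 0 ≤ w) :
    0 ≤ hyp01 m w ^ 2 - w * hyp01 (m + 1) w ^ 2
      - (m - 1 / 2) * hyp01 m w * hyp01 (m + 1) w := by
  have hm0 : 0 < m := by linarith
  set U : ℝ → ℝ := fun w => hyp01 m w ^ 2 - w * hyp01 (m + 1) w ^ 2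
      - (m - 1 / 2) * hyp01 m w * hyp01 (m + 1) w with hU
  set c : ℝ := m - 1 / 2 with hc
  have hc0 : 0 ≤ c := by linarith
  have hU0 : 0 ≤ U 0 := by
    simp only [hU, hyp01_zero, Real.Gamma_add_one hm0.ne', mul_inv]
    have hG := inv_pos.2 (Real.Gamma_pos_of_pos hm0)
    set G := (Real.Gamma m)⁻¹
    have : c * m⁻¹ ≤ 1 := by
      rw [← div_eq_mul_inv, div_le_one hm0]
      linarith
    nlinarith [mul_pos hG hG]
  have hcont : Continuous U := by
    have h1 := continuous_hyp01 hm0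
    have h2 := continuous_hyp01 (m := m + 1) (by linarith)
    fun_prop
  have hdU : ∀ w, HasDerivAt U (c * (hyp01 (m + 1) w ^ 2 - hyp01 m w * hyp01 (m + 2) w)) w := by
    intro w
    have h1 := hasDerivAt_hyp01 hm0 w
    have h2 := hasDerivAt_hyp01 (m := m + 1) (by linarith) w
    rw [show m + 1 + 1 = m + 2 by ring] at h2
    have := ((h1.pow 2).sub ((hasDerivAt_id w).mul (h2.pow 2))).sub
      ((h1.const_mul c).mul h2)
    refine this.congr_deriv ?_
    have hr := hyp01_recurrence hm0 w
    simp
    linear_combination 2 * hyp01 (m + 1) w * hr + 2 * hyp01 (m + 1) w ^ 2 * hc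
  have hmono : MonotoneOn (fun w => w ^ c * U w) (Set.Ici 0) := by
    refine monotoneOn_of_deriv_nonneg (convex_Ici 0)
      ((Real.continuous_rpow_const hc0).mul hcont).continuousOn ?_ ?_
    · intro w hw
      rw [interior_Ici] at hw
      exact ((Real.hasDerivAt_rpow_const (Or.inl hw.ne')).mul
        (hdU w)).differentiableAt.differentiableWithinAt
    · intro w hw
      rw [interior_Ici] at hw
      have hw0 : 0 < w := hw
      have hd := (Real.hasDerivAt_rpow_const (p := c) (Or.inl hw0.ne')).mul (hdU w)
      rw [show deriv (fun w => w ^ c * U w) w = _ from hd.deriv]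
      have hr := hyp01_recurrence hm0 w
      have e : c * w ^ (c - 1) * U w
          + w ^ c * (c * (hyp01 (m + 1) w ^ 2 - hyp01 m w * hyp01 (m + 2) w))
          = w ^ (c - 1) * (1 / 2 * c * hyp01 m w * hyp01 (m + 1) w) := by
        rw [show w ^ c = w ^ (c - 1) * w by rw [← Real.rpow_add_one hw0.ne']; ring_nf]
        simp only [hU]
        linear_combination (w ^ (c - 1) * c * hyp01 m w) * hr
          - w ^ (c - 1) * c * hyp01 m w * hyp01 (m + 1) w * hc
      rw [e]
      have := hyp01_pos hm0 hw0.le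
      have := hyp01_pos (m := m + 1) (by linarith) hw0.le
      positivity
  rcases hw.eq_or_lt with rfl | hw0
  · exact hU0
  · have h := hmono (Set.self_mem_Ici (a := (0 : ℝ))) hw hw
    have h0 : 0 ≤ (0 : ℝ) ^ c * U 0 := mul_nonneg (Real.rpow_nonneg le_rfl _) hU0
    exact nonneg_of_mul_nonneg_right (h0.trans h) (Real.rpow_pos_of_pos hw0 _)

/-! ### The noncentral chi-squared law -/

/-- Finite measures whose moment-generating functions are finite and agree on `(-∞, 1)` are
equal. -/
theorem ext_of_mgf_eq_of_lt_one {μ ν : Measure ℝ} [IsFiniteMeasure μ] [IsFiniteMeasure ν]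
    (hμ : ∀ t < 1, Integrable (fun x => Real.exp (t * x)) μ)
    (hν : ∀ t < 1, Integrable (fun x => Real.exp (t * x)) ν)
    (h : ∀ t < 1, ∫ x, Real.exp (t * x) ∂μ = ∫ x, Real.exp (t * x) ∂ν) : μ = ν := by
  have hsub : ∀ {ρ : Measure ℝ}, (∀ t < 1, Integrable (fun x => Real.exp (t * x)) ρ) →
      Set.Iio (1 : ℝ) ⊆ interior (integrableExpSet id ρ) := fun hρ =>
    interior_maximal (fun t ht => hρ t ht) isOpen_Iio
  have han : ∀ {ρ : Measure ℝ}, (∀ t < 1, Integrable (fun x => Real.exp (t * x)) ρ) →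
      AnalyticOnNhd ℂ (complexMGF id ρ) {z | z.re < 1} := fun hρ =>
    analyticOnNhd_complexMGF.mono fun z hz => hsub hρ hz
  -- Identity theorem: agreement at real points near `0` spreads over the half-plane, hence to the
  -- imaginary axis, where the values are the characteristic functions.
  have heq : Set.EqOn (complexMGF id μ) (complexMGF id ν) {z | z.re < 1} := by
    refine (han hμ).eqOn_of_preconnected_of_frequently_eq (han hν)
      (convex_halfSpace_re_lt 1).isPreconnected (z₀ := ((0 : ℝ) : ℂ)) (by simp) ?_
    have h_real : ∃ᶠ x : ℝ in 𝓝[≠] (0 : ℝ), complexMGF id μ x = complexMGF id ν x := by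
      refine Eventually.frequently ?_
      filter_upwards [nhdsWithin_le_nhds (Iio_mem_nhds one_pos)] with x hx
      rw [complexMGF_ofReal, complexMGF_ofReal]
      congr 1
      exact h x hx
    rw [frequently_iff_seq_forall] at h_real ⊢
    obtain ⟨xs, hx_tendsto, hx_eq⟩ := h_real
    refine ⟨fun n => xs n, ?_, fun n => by simp [hx_eq]⟩
    rw [tendsto_nhdsWithin_iff] at hx_tendsto ⊢
    refine ⟨(Complex.continuous_ofReal.tendsto _).comp hx_tendsto.1, ?_⟩
    simpa using hx_tendsto.2
  refine Measure.ext_of_charFun (funext fun t => ?_)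
  rw [← complexMGF_id_mul_I, ← complexMGF_id_mul_I]
  exact heq (by simp)

/-- Density of half a noncentral chi-squared variable with `2 m` degrees of freedom and
noncentrality parameter `2 κ`. -/
noncomputable def ncDensity (m κ y : ℝ) : ℝ :=
  Real.exp (-y - κ) * y ^ (m - 1) * hyp01 m (κ * y)

theorem ncDensity_pos {m κ y : ℝ} (hm : 0 < m) (hκ : 0 ≤ κ) (hy : 0 < y) :
    0 < ncDensity m κ y :=
  mul_pos (mul_pos (Real.exp_pos _) (Real.rpow_pos_of_pos hy _)) (hyp01_pos hm (by positivity))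

theorem measurable_ncDensity {m : ℝ} (hm : 0 < m) (κ : ℝ) : Measurable (ncDensity m κ) := by
  have := (continuous_hyp01 hm).measurable
  unfold ncDensity
  fun_prop

/-- Law of half a noncentral chi-squared variable with `2 m` degrees of freedom and
noncentrality parameter `2 κ`. -/
noncomputable def ncMeasure (m κ : ℝ) : Measure ℝ :=
  (volume.restrict (Set.Ioi 0)).withDensity fun y => ENNReal.ofReal (ncDensity m κ y)

/-- The density is a Poisson mixture of Gamma densities. By Tonelli each term is a Gamma integral,
and the Poisson weights then sum to an exponential. -/
theorem lintegral_exp_mul_ncDensity {m κ : ℝ} (hm : 0 < m) (hκ : 0 ≤ κ) {t : ℝ} (ht : t < 1) :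
    ∫⁻ y in Set.Ioi 0, ENNReal.ofReal (Real.exp (t * y) * ncDensity m κ y)
      = ENNReal.ofReal ((1 - t) ^ (-m) * Real.exp (κ * (t / (1 - t)))) := by
  have hr : 0 < 1 - t := by linarith
  have hG : ∀ j : ℕ, 0 < Real.Gamma (m + j) := fun j => Real.Gamma_pos_of_pos (by positivity)
  have hF : ∀ j : ℕ, (0 : ℝ) < j.factorial := fun j => by exact_mod_cast j.factorial_pos
  set C : ℕ → ℝ := fun j => Real.exp (-κ) * κ ^ j / (j.factorial * Real.Gamma (m + j)) with hC
  have hC0 : ∀ j, 0 ≤ C j := fun j => by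
    have := hG j
    have := hF j
    positivity
  have hterm : ∀ j : ℕ, ∫⁻ y in Set.Ioi 0,
      ENNReal.ofReal (C j * (y ^ (m + j - 1) * Real.exp (-((1 - t) * y))))
      = ENNReal.ofReal (Real.exp (-κ) * (1 - t) ^ (-m) * ((κ / (1 - t)) ^ j / j.factorial)) := by
    intro j
    have hI := Real.integral_rpow_mul_exp_neg_mul_Ioi (a := m + j) (r := 1 - t) (by positivity) hr
    have hint : Integrable (fun y : ℝ => y ^ (m + j - 1) * Real.exp (-((1 - t) * y)))
        (volume.restrict (Set.Ioi 0)) := by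
      refine .of_integral_ne_zero ?_
      rw [hI]
      have := hG j
      positivity
    rw [← ofReal_integral_eq_lintegral_ofReal (hint.const_mul _), integral_const_mul, hI]
    · congr 1
      have := hG j
      have := hF j
      rw [one_div, Real.inv_rpow hr.le, Real.rpow_add hr, Real.rpow_natCast, Real.rpow_neg hr.le, hC,
        div_pow]
      have : 0 < (1 - t) ^ m := Real.rpow_pos_of_pos hr _
      field_simp
    · filter_upwards [ae_restrict_mem measurableSet_Ioi] with y hy
      have hy : 0 < y := hy
      exact mul_nonneg (hC0 j) (by positivity)
  calc ∫⁻ y in Set.Ioi 0, ENNReal.ofReal (Real.exp (t * y) * ncDensity m κ y)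
      = ∫⁻ y in Set.Ioi 0, ∑' j : ℕ,
        ENNReal.ofReal (C j * (y ^ (m + j - 1) * Real.exp (-((1 - t) * y)))) := by
        refine setLIntegral_congr_fun measurableSet_Ioi fun y hy => ?_
        have hy : 0 < y := hy
        have hs := (summable_hyp01 hm (κ * y)).mul_left
          (Real.exp (t * y) * (Real.exp (-y - κ) * y ^ (m - 1)))
        have e : ∀ j : ℕ, Real.exp (t * y) * (Real.exp (-y - κ) * y ^ (m - 1)) *
            ((κ * y) ^ j / (j.factorial * Real.Gamma (m + j)))
            = C j * (y ^ (m + j - 1) * Real.exp (-((1 - t) * y))) := by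
          intro j
          have e1 : Real.exp (t * y) * Real.exp (-y - κ)
              = Real.exp (-κ) * Real.exp (-((1 - t) * y)) := by
            rw [← Real.exp_add, ← Real.exp_add]
            ring_nf
          have e2 : y ^ (m + j - 1) = y ^ (m - 1) * y ^ j := by
            rw [← Real.rpow_natCast, ← Real.rpow_add hy]
            ring_nf
          rw [e2, hC, mul_pow, ← mul_assoc, e1]
          ring
        show ENNReal.ofReal (Real.exp (t * y) * ncDensity m κ y) = _
        rw [← ENNReal.ofReal_tsum_of_nonneg]
        · congr 1
          rw [ncDensity, hyp01, ← mul_assoc, ← tsum_mul_left]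
          exact tsum_congr e
        · exact fun j => mul_nonneg (hC0 j) (by positivity)
        · exact hs.congr e
    _ = ∑' j : ℕ,
        ENNReal.ofReal (Real.exp (-κ) * (1 - t) ^ (-m) * ((κ / (1 - t)) ^ j / j.factorial)) := by
        rw [lintegral_tsum fun j => by fun_prop]
        exact tsum_congr hterm
    _ = ENNReal.ofReal ((1 - t) ^ (-m) * Real.exp (κ * (t / (1 - t)))) := by
        have hs := Real.summable_pow_div_factorial (κ / (1 - t))
        rw [← ENNReal.ofReal_tsum_of_nonneg (fun j => by positivity) (hs.mul_left _), tsum_mul_left]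
        congr 1
        have : ∑' j : ℕ, (κ / (1 - t)) ^ j / j.factorial = Real.exp (κ / (1 - t)) := by
          rw [Real.exp_eq_exp_ℝ, NormedSpace.exp_eq_tsum_div]
        rw [this, mul_right_comm, ← Real.exp_add, mul_comm]
        congr 2
        field_simp
        ring

theorem lintegral_ncDensity {m κ : ℝ} (hm : 0 < m) (hκ : 0 ≤ κ) :
    ∫⁻ y in Set.Ioi 0, ENNReal.ofReal (ncDensity m κ y) = 1 := by
  simpa using lintegral_exp_mul_ncDensity hm hκ (t := 0) one_pos

theorem isProbabilityMeasure_ncMeasure {m κ : ℝ} (hm : 0 < m) (hκ : 0 ≤ κ) :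
    IsProbabilityMeasure (ncMeasure m κ) := by
  refine ⟨?_⟩
  rw [ncMeasure, withDensity_apply _ MeasurableSet.univ, Measure.restrict_univ,
    lintegral_ncDensity hm hκ]

theorem lintegral_exp_ncMeasure {m κ : ℝ} (hm : 0 < m) (hκ : 0 ≤ κ) {t : ℝ} (ht : t < 1) :
    ∫⁻ y, ENNReal.ofReal (Real.exp (t * y)) ∂(ncMeasure m κ)
      = ENNReal.ofReal ((1 - t) ^ (-m) * Real.exp (κ * (t / (1 - t)))) := by
  rw [ncMeasure, lintegral_withDensity_eq_lintegral_mul _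
    (measurable_ncDensity hm κ).ennreal_ofReal (by fun_prop),
    ← lintegral_exp_mul_ncDensity hm hκ ht]
  refine lintegral_congr fun y => ?_
  rw [Pi.mul_apply, mul_comm, ENNReal.ofReal_mul (Real.exp_pos _).le]

theorem integrable_exp_ncMeasure {m κ : ℝ} (hm : 0 < m) (hκ : 0 ≤ κ) {t : ℝ} (ht : t < 1) :
    Integrable (fun y => Real.exp (t * y)) (ncMeasure m κ) := by
  refine ⟨by fun_prop, ?_⟩
  rw [hasFiniteIntegral_iff_ofReal (ae_of_all _ fun y => (Real.exp_pos _).le),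
    lintegral_exp_ncMeasure hm hκ ht]
  exact ENNReal.ofReal_lt_top

theorem integral_exp_ncMeasure {m κ : ℝ} (hm : 0 < m) (hκ : 0 ≤ κ) {t : ℝ} (ht : t < 1) :
    ∫ y, Real.exp (t * y) ∂(ncMeasure m κ) = (1 - t) ^ (-m) * Real.exp (κ * (t / (1 - t))) := by
  have hr : 0 < 1 - t := by linarith
  rw [integral_eq_lintegral_of_nonneg_ae (ae_of_all _ fun y => (Real.exp_pos _).le) (by fun_prop),
    lintegral_exp_ncMeasure hm hκ ht, ENNReal.toReal_ofReal (by positivity)]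

theorem integral_exp_sq_gaussianReal (a c : ℝ) {v : NNReal} (hv : v ≠ 0) {t : ℝ} (ht : t < 1) :
    ∫ y, Real.exp (t * ((y - c) ^ 2 / (2 * v))) ∂(gaussianReal a v)
      = (1 - t) ^ (-(1 / 2 : ℝ)) * Real.exp ((a - c) ^ 2 / (2 * v) * (t / (1 - t))) := by
  have hr : 0 < 1 - t := by linarith
  have hv0 : (0 : ℝ) < v := lt_of_le_of_ne v.2 (fun h => hv (NNReal.coe_eq_zero.1 h.symm))
  -- Exponential tilting of the Gaussian by the quadratic gives a multiple of a Gaussian with this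
  -- variance and mean `(a - t c)/(1 - t)`.
  set v' : NNReal := (v / (1 - t)).toNNReal with hv'
  have hv'c : (v' : ℝ) = v / (1 - t) := Real.coe_toNNReal _ (by positivity)
  have hv'0 : v' ≠ 0 := by
    intro h
    rw [h] at hv'c
    have : 0 < (v : ℝ) / (1 - t) := by positivity
    simp only [NNReal.coe_zero] at hv'c
    linarith
  rw [integral_gaussianReal_eq_integral_smul hv]
  have e : ∀ y, gaussianPDFReal a v y • Real.exp (t * ((y - c) ^ 2 / (2 * v)))
      = ((1 - t) ^ (-(1 / 2 : ℝ)) * Real.exp ((a - c) ^ 2 / (2 * v) * (t / (1 - t)))) *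
        gaussianPDFReal ((a - t * c) / (1 - t)) v' y := by
    intro y
    rw [gaussianPDFReal, gaussianPDFReal, hv'c, smul_eq_mul, mul_assoc, ← Real.exp_add,
      Real.rpow_neg hr.le, ← Real.sqrt_eq_rpow,
      show 2 * Real.pi * ((v : ℝ) / (1 - t)) = 2 * Real.pi * v / (1 - t) by ring,
      Real.sqrt_div (by positivity)]
    have hs : 0 < Real.sqrt (1 - t) := Real.sqrt_pos.2 hr
    have hs2 : 0 < Real.sqrt (2 * Real.pi * v) := Real.sqrt_pos.2 (by positivity)
    have ex : -(y - a) ^ 2 / (2 * v) + t * ((y - c) ^ 2 / (2 * v))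
        = (a - c) ^ 2 / (2 * v) * (t / (1 - t))
          + -(y - (a - t * c) / (1 - t)) ^ 2 / (2 * (v / (1 - t))) := by
      field_simp
      ring
    rw [ex, Real.exp_add]
    field_simp
  simp_rw [e]
  rw [integral_const_mul, integral_gaussianPDFReal_eq_one _ hv'0, mul_one]

/-- Squared distance of a Gaussian vector to a fixed point has a noncentral chi-squared law. -/
theorem map_gaussianLaw_dist_sq {n : ℕ} (hn : 0 < n) (a c : Fin n → ℝ) {v : NNReal} (hv : v ≠ 0) :
    (gaussianLaw a v).map (fun y => ∑ i, (y i - c i) ^ 2 / (2 * v))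
      = ncMeasure ((n : ℝ) / 2) (∑ i, (a i - c i) ^ 2 / (2 * v)) := by
  have hm : (0 : ℝ) < (n : ℝ) / 2 := by positivity
  have hκ : (0 : ℝ) ≤ ∑ i, (a i - c i) ^ 2 / (2 * v) :=
    Finset.sum_nonneg fun i _ => by positivity
  have hmeas : Measurable fun y : Fin n → ℝ => ∑ i, (y i - c i) ^ 2 / (2 * v) := by fun_prop
  have := isProbabilityMeasure_ncMeasure hm hκ
  have hG : IsProbabilityMeasure (gaussianLaw a v) := by
    unfold gaussianLaw
    infer_instance
  have := Measure.isProbabilityMeasure_map (μ := gaussianLaw a v) hmeas.aemeasurable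
  have hint : ∀ t < (1 : ℝ),
      ∫ y, Real.exp (t * y) ∂((gaussianLaw a v).map fun y => ∑ i, (y i - c i) ^ 2 / (2 * v))
        = (1 - t) ^ (-((n : ℝ) / 2)) *
          Real.exp ((∑ i, (a i - c i) ^ 2 / (2 * v)) * (t / (1 - t))) := by
    intro t ht
    have hr : 0 < 1 - t := by linarith
    rw [integral_map hmeas.aemeasurable (by fun_prop)]
    simp_rw [Finset.mul_sum, Real.exp_sum]
    rw [gaussianLaw, integral_fintype_prod_eq_prod
      (f := fun i y => Real.exp (t * ((y - c i) ^ 2 / (2 * v))))]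
    simp_rw [integral_exp_sq_gaussianReal _ _ hv ht]
    rw [Finset.prod_mul_distrib, ← Real.exp_sum, Finset.sum_mul, Finset.prod_const, Finset.card_univ,
      Fintype.card_fin, ← Real.rpow_mul_natCast hr.le]
    congr 2
    ring
  refine ext_of_mgf_eq_of_lt_one (fun t ht => ?_) (fun t ht => integrable_exp_ncMeasure hm hκ ht)
    fun t ht => ?_
  · refine .of_integral_ne_zero ?_
    rw [hint t ht]
    have hr : 0 < 1 - t := by linarith
    positivity
  · rw [hint t ht, integral_exp_ncMeasure hm hκ ht]

/-! ### Stirling's lower bound for the Gamma function -/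

/-- The right side does not increase under `x ↦ x + 1`, because `log(1 + 1/x) ≥ 2/(2x + 1)`. Along
`x + k` it is bounded below by a sequence tending to the left side. -/
theorem stirling_le_log_Gamma {x : ℝ} (hx : 0 < x) :
    1 / 2 * Real.log (2 * Real.pi) ≤ Real.log (Real.Gamma x) + x - (x - 1 / 2) * Real.log x := by
  set T : ℝ → ℝ := fun x => Real.log (Real.Gamma x) + x - (x - 1 / 2) * Real.log x with hT
  have hfeq : ∀ {y : ℝ}, 0 < y →
      Real.log (Real.Gamma (y + 1)) = Real.log (Real.Gamma y) + Real.log y := fun {y} hy => by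
    rw [Real.Gamma_add_one hy.ne', Real.log_mul hy.ne' (Real.Gamma_pos_of_pos hy).ne', add_comm]
  have hstep : ∀ y, 0 < y → T (y + 1) ≤ T y := by
    intro y hy
    have h1 := Real.le_log_one_add_of_nonneg (x := 1 / y) (by positivity)
    rw [show 1 + 1 / y = (y + 1) / y by field_simp, Real.log_div (by positivity) hy.ne',
      show 2 * (1 / y) / (1 / y + 2) = 2 / (2 * y + 1) by field_simp; ring,
      div_le_iff₀ (by positivity)] at h1
    simp only [hT, hfeq hy]
    linarith
  have hanti : ∀ k : ℕ, T (x + k) ≤ T x := by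
    intro k
    induction k with
    | zero => simp
    | succ k ih =>
      have := hstep (x + k) (by positivity)
      push_cast
      rw [← add_assoc]
      linarith
  -- The vanishing error is `log((x+k+1)/k) ≤ (x+1)/k` multiplied by `x + k + 1/2`, less the
  -- constant `x + 1`.
  have hlim : Tendsto (fun k : ℕ => Real.log (Real.Gamma x) - Real.BohrMollerup.logGammaSeq x k
      + 1 / 2 * Real.log (2 * Real.pi) - ((x + 1 / 2) * (x + 1)) * (k : ℝ)⁻¹) atTop
      (𝓝 (1 / 2 * Real.log (2 * Real.pi))) := by
    have h1 := Real.BohrMollerup.tendsto_log_gamma hx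
    have h2 := tendsto_inv_atTop_nhds_zero_nat (𝕜 := ℝ)
    have := ((h1.const_sub (Real.log (Real.Gamma x))).add_const
      (1 / 2 * Real.log (2 * Real.pi))).sub (h2.const_mul ((x + 1 / 2) * (x + 1)))
    simpa using this
  refine le_of_tendsto hlim ?_
  filter_upwards [eventually_ge_atTop 1] with k hk
  refine le_trans ?_ (hanti (k + 1))
  have hk0 : (0 : ℝ) < k := by exact_mod_cast hk
  have hsum := Real.BohrMollerup.f_add_nat_eq (f := fun y => Real.log (Real.Gamma y))
    (fun {y} hy => hfeq hy) hx (k + 1)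
  have hst := Stirling.le_log_factorial_stirling (n := k) (by omega)
  have hlog : Real.log (x + ((k + 1 : ℕ) : ℝ)) - Real.log k ≤ (x + 1) * (k : ℝ)⁻¹ := by
    rw [← Real.log_div (by positivity) hk0.ne']
    refine (Real.log_le_sub_one_of_pos (by positivity)).trans_eq ?_
    push_cast
    field_simp
    ring
  have hmul := mul_le_mul_of_nonneg_left hlog (show 0 ≤ x + k + 1 / 2 by positivity)
  have e : (x + k + 1 / 2) * ((x + 1) * (k : ℝ)⁻¹)
      = (x + 1 / 2) * (x + 1) * (k : ℝ)⁻¹ + (x + 1) := by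
    field_simp
    ring
  rw [e] at hmul
  simp only [hT, hsum, Real.BohrMollerup.logGammaSeq]
  push_cast at hmul ⊢
  linarith

/-! ### A local limit bound -/

/-- The function `hyp01`, along `w = b (b + m)`, normalized by its leading asymptotic term. -/
noncomputable def hypRatio (m b : ℝ) : ℝ :=
  hyp01 m (b * (b + m)) * (b + m) ^ (m - 1) * Real.exp (-(2 * b + m)) *
    Real.sqrt (2 * Real.pi * (2 * b + m))

/-- The factor of the derivative of `hypRatio` which determines its sign. -/
noncomputable def hypSlope (m b : ℝ) : ℝ :=
  (b + m) * hyp01 (m + 1) (b * (b + m)) - (1 + b / (2 * b + m) ^ 2) * hyp01 m (b * (b + m))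

theorem hypRatio_zero_le_one {m : ℝ} (hm : 0 < m) : hypRatio m 0 ≤ 1 := by
  have hG := Real.Gamma_pos_of_pos hm
  have h := stirling_le_log_Gamma hm
  have hpos : 0 < hypRatio m 0 := by
    have := hyp01_pos hm (le_refl 0)
    simp only [hypRatio, zero_mul, mul_zero, zero_add]
    positivity
  rw [← Real.log_nonpos_iff hpos.le]
  simp only [hypRatio, zero_mul, mul_zero, zero_add, hyp01_zero]
  rw [Real.log_mul (by positivity) (by positivity), Real.log_mul (by positivity) (by positivity),
    Real.log_mul (by positivity) (by positivity), Real.log_inv, Real.log_rpow hm, Real.log_exp,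
    Real.log_sqrt (by positivity), Real.log_mul (by positivity) hm.ne']
  linarith

theorem hasDerivAt_hyp01_comp {m k b : ℝ} (hk : 0 < k) :
    HasDerivAt (fun b => hyp01 k (b * (b + m))) ((2 * b + m) * hyp01 (k + 1) (b * (b + m))) b := by
  have h1 : HasDerivAt (fun b => b * (b + m)) (1 * (b + m) + b * 1) b :=
    (hasDerivAt_id b).mul ((hasDerivAt_id b).add_const m)
  refine ((hasDerivAt_hyp01 hk _).comp b h1).congr_deriv ?_
  ring

theorem hasDerivAt_hypRatio {m b : ℝ} (hm : 0 < m) (hb : 0 ≤ b) :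
    HasDerivAt (hypRatio m) ((b + m) ^ (m - 2) * Real.exp (-(2 * b + m)) *
      Real.sqrt (2 * Real.pi * (2 * b + m)) * (2 * b + m) * hypSlope m b) b := by
  have hA : 0 < b + m := by linarith
  have hs : 0 < 2 * b + m := by linarith
  have h1 := hasDerivAt_hyp01_comp (m := m) (b := b) hm
  have hl : HasDerivAt (fun b => 2 * b + m) 2 b := by
    simpa using ((hasDerivAt_id b).const_mul 2).add_const m
  have hlA : HasDerivAt (fun b => b + m) 1 b := (hasDerivAt_id b).add_const m
  have h2 := hlA.rpow_const (p := m - 1) (Or.inl hA.ne')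
  have h3 := hl.neg.exp
  have h4 := (hl.const_mul (2 * Real.pi)).sqrt (by positivity)
  refine (((h1.mul h2).mul h3).mul h4).congr_deriv ?_
  have e1 : (b + m) ^ (m - 1) = (b + m) ^ (m - 2) * (b + m) := by
    rw [← Real.rpow_add_one hA.ne']
    ring_nf
  have e2 : (b + m) ^ (m - 1 - 1) = (b + m) ^ (m - 2) := by ring_nf
  have hq := Real.mul_self_sqrt (show 0 ≤ 2 * Real.pi * (2 * b + m) by positivity)
  have hq0 : 0 < Real.sqrt (2 * Real.pi * (2 * b + m)) := Real.sqrt_pos.2 (by positivity)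
  have e3 : 2 * Real.pi * 2 / (2 * Real.sqrt (2 * Real.pi * (2 * b + m)))
      = Real.sqrt (2 * Real.pi * (2 * b + m)) / (2 * b + m) := by
    rw [div_eq_div_iff (by positivity) hs.ne']
    linear_combination -2 * hq
  simp only [Pi.mul_apply, Pi.neg_apply, hypSlope]
  rw [e1, e2, e3]
  field_simp
  ring

/-- By the recurrence `hypSlope` solves a first-order linear equation driven by a multiple of `hyp01
m`; the weight is its integrating factor. What remains has the sign of `3b - m`. -/
theorem hasDerivAt_hypSlope_weighted {m b : ℝ} (hm : 0 < m) (hb : 0 < b) :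
    HasDerivAt (fun b => b ^ m * Real.exp (2 * b) / Real.sqrt (2 * b + m) * hypSlope m b)
      (b ^ m * Real.exp (2 * b) / Real.sqrt (2 * b + m) * hyp01 m (b * (b + m)) *
        ((3 * b - m) / (2 * b + m) ^ 3)) b := by
  have hA : 0 < b + m := by linarith
  have hs : 0 < 2 * b + m := by linarith
  have hl : HasDerivAt (fun b => 2 * b + m) 2 b := by
    simpa using ((hasDerivAt_id b).const_mul 2).add_const m
  have hl2 : HasDerivAt (fun b : ℝ => 2 * b) 2 b := by
    simpa using (hasDerivAt_id b).const_mul 2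
  have hlA : HasDerivAt (fun b => b + m) 1 b := (hasDerivAt_id b).add_const m
  have hφ := hasDerivAt_hyp01_comp (m := m) (b := b) hm
  have hφ1 := hasDerivAt_hyp01_comp (m := m) (b := b) (k := m + 1) (by linarith)
  have hc : HasDerivAt (fun b => 1 + b / (2 * b + m) ^ 2)
      (1 / (2 * b + m) ^ 2 - 4 * b / (2 * b + m) ^ 3) b := by
    have := ((hasDerivAt_id b).div (hl.pow 2) (by simp [hs.ne'])).const_add 1
    refine this.congr_deriv ?_
    simp
    field_simp
    ring
  have hS : HasDerivAt (hypSlope m) _ b := (hlA.mul hφ1).sub (hc.mul hφ)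
  have hq := Real.mul_self_sqrt hs.le
  have hq0 : 0 < Real.sqrt (2 * b + m) := Real.sqrt_pos.2 hs
  have hw : HasDerivAt (fun b => b ^ m * Real.exp (2 * b) / Real.sqrt (2 * b + m))
      (b ^ m * Real.exp (2 * b) / Real.sqrt (2 * b + m) * (m / b + 2 - 1 / (2 * b + m))) b := by
    refine (((Real.hasDerivAt_rpow_const (p := m) (Or.inl hb.ne')).mul hl2.exp).div
      (hl.sqrt hs.ne') hq0.ne').congr_deriv ?_
    have e1 : b ^ m = b ^ (m - 1) * b := by
      rw [← Real.rpow_add_one hb.ne']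
      ring_nf
    have e2 : 2 / (2 * Real.sqrt (2 * b + m)) = Real.sqrt (2 * b + m) / (2 * b + m) := by
      rw [div_eq_div_iff (by positivity) hs.ne']
      linear_combination -2 * hq
    simp only [Pi.mul_apply]
    rw [e2, e1, sq (Real.sqrt _), hq]
    generalize Real.sqrt (2 * b + m) = q at *
    have e3 : ∀ X : ℝ, X / q = X * q / (2 * b + m) := by
      intro X
      rw [← hq]
      field_simp
    rw [e3]
    field_simp
  refine (hw.mul hS).congr_deriv ?_
  have hr := hyp01_recurrence hm (b * (b + m))
  rw [show m + 2 = m + 1 + 1 by ring] at hr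
  have hr2 : hyp01 (m + 1 + 1) (b * (b + m))
      = (hyp01 m (b * (b + m)) - m * hyp01 (m + 1) (b * (b + m))) / (b * (b + m)) := by
    rw [eq_div_iff (by positivity)]
    linarith
  simp only [hypSlope]
  rw [hr2]
  generalize hyp01 m (b * (b + m)) = f
  generalize hyp01 (m + 1) (b * (b + m)) = g
  generalize b ^ m * Real.exp (2 * b) / Real.sqrt (2 * b + m) = z
  field_simp
  ring

/-- If `hypRatio` exceeds `1` somewhere then it is monotone from there on. -/
theorem hypRatio_le_of_one_lt {m b₁ b : ℝ} (hm : 0 < m) (hb₁ : 0 ≤ b₁) (h : 1 < hypRatio m b₁)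
    (hb : b₁ ≤ b) : hypRatio m b₁ ≤ hypRatio m b := by
  set N : ℝ → ℝ := fun b => b ^ m * Real.exp (2 * b) / Real.sqrt (2 * b + m) * hypSlope m b with hN
  have hpos : ∀ {b : ℝ}, 0 < b → 0 < b ^ m * Real.exp (2 * b) / Real.sqrt (2 * b + m) := fun hb =>
    div_pos (mul_pos (Real.rpow_pos_of_pos hb _) (Real.exp_pos _)) (Real.sqrt_pos.2 (by positivity))
  have hcN : ContinuousOn N (Set.Ici 0) := by
    intro b hb
    have hb : 0 ≤ b := hb
    have hs : 0 < 2 * b + m := by linarith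
    have h1 := continuous_hyp01 hm
    have h2 := continuous_hyp01 (m := m + 1) (by linarith)
    refine ContinuousAt.continuousWithinAt ?_
    refine ContinuousAt.mul (ContinuousAt.div (ContinuousAt.mul
      (Real.continuousAt_rpow_const _ _ (Or.inr hm.le)) (by fun_prop)) (by fun_prop)
      (Real.sqrt_pos.2 hs).ne') ?_
    unfold hypSlope
    refine ContinuousAt.sub (by fun_prop) (ContinuousAt.mul (ContinuousAt.add (by fun_prop)
      (ContinuousAt.div (by fun_prop) (by fun_prop) (by positivity))) (by fun_prop))
  have hdN : ∀ b, 0 < b → deriv N b = b ^ m * Real.exp (2 * b) / Real.sqrt (2 * b + m) *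
      hyp01 m (b * (b + m)) * ((3 * b - m) / (2 * b + m) ^ 3) := fun b hb =>
    (hasDerivAt_hypSlope_weighted hm hb).deriv
  have hN0 : N 0 = 0 := by simp [hN, Real.zero_rpow hm.ne']
  -- `N` starts at `0`, falls up to `m/3` and rises afterwards, so once it is positive it stays
  -- positive.
  have hanti : AntitoneOn N (Set.Icc 0 (m / 3)) := by
    refine antitoneOn_of_deriv_nonpos (convex_Icc _ _) (hcN.mono Set.Icc_subset_Ici_self) ?_ ?_
    · intro b hb
      rw [interior_Icc] at hb
      exact (hasDerivAt_hypSlope_weighted hm hb.1).differentiableAt.differentiableWithinAt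
    · intro b hb
      rw [interior_Icc] at hb
      have hb0 : 0 < b := hb.1
      rw [hdN b hb0]
      have h3 : 3 * b - m ≤ 0 := by linarith [hb.2]
      have := hyp01_pos hm (w := b * (b + m)) (by positivity)
      exact mul_nonpos_of_nonneg_of_nonpos (mul_pos (hpos hb0) this).le
        (div_nonpos_of_nonpos_of_nonneg h3 (by positivity))
  have hmono : MonotoneOn N (Set.Ici (m / 3)) := by
    refine monotoneOn_of_deriv_nonneg (convex_Ici _)
      (hcN.mono (Set.Ici_subset_Ici.2 (by positivity))) ?_ ?_
    · intro b hb
      rw [interior_Ici] at hb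
      have hb : m / 3 < b := hb
      have hb0 : 0 < b := by linarith
      exact (hasDerivAt_hypSlope_weighted hm hb0).differentiableAt.differentiableWithinAt
    · intro b hb
      rw [interior_Ici] at hb
      have hb : m / 3 < b := hb
      have hb0 : 0 < b := by linarith
      rw [hdN b hb0]
      have h3 : 0 ≤ 3 * b - m := by linarith
      have := hyp01_pos hm (w := b * (b + m)) (by positivity)
      exact mul_nonneg (mul_pos (hpos hb0) this).le (div_nonneg h3 (by positivity))
  have hd : ∀ b, 0 ≤ b → HasDerivAt (hypRatio m) _ b := fun b hb => hasDerivAt_hypRatio hm hb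
  have hcr : ContinuousOn (hypRatio m) (Set.Ici 0) := fun b hb =>
    (hd b hb).continuousAt.continuousWithinAt
  have h0 := hypRatio_zero_le_one hm
  have hb₁0 : 0 < b₁ := by
    rcases hb₁.eq_or_lt with rfl | h'
    · linarith
    · exact h'
  -- Climbing from at most `1` at `0` to above `1` at `b₁` forces a point with positive slope; it
  -- must lie beyond `m/3`.
  obtain ⟨b₂, hb₂, hslope⟩ := exists_deriv_eq_slope (hypRatio m) hb₁0
    (hcr.mono Set.Icc_subset_Ici_self)
    fun b hb => (hd b hb.1.le).differentiableAt.differentiableWithinAt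
  have hb₂0 : 0 < b₂ := hb₂.1
  have hfac : ∀ b, 0 < b → 0 < (b + m) ^ (m - 2) * Real.exp (-(2 * b + m)) *
      Real.sqrt (2 * Real.pi * (2 * b + m)) * (2 * b + m) := fun b hb => by positivity
  have hS₂ : 0 < hypSlope m b₂ := by
    rw [(hd b₂ hb₂0.le).deriv] at hslope
    have : 0 < (hypRatio m b₁ - hypRatio m 0) / (b₁ - 0) := div_pos (by linarith) (by linarith)
    rw [← hslope] at this
    exact pos_of_mul_pos_right this (hfac b₂ hb₂0).le
  have hN₂ : 0 < N b₂ := mul_pos (hpos hb₂0) hS₂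
  have hm3 : m / 3 ≤ b₂ := by
    by_contra! hlt
    have := hanti ⟨le_rfl, by positivity⟩ ⟨hb₂0.le, hlt.le⟩ hb₂0.le
    rw [hN0] at this
    linarith
  have hmonor : MonotoneOn (hypRatio m) (Set.Ici b₂) := by
    refine monotoneOn_of_deriv_nonneg (convex_Ici _)
      (hcr.mono (Set.Ici_subset_Ici.2 hb₂0.le)) ?_ ?_
    · intro b hb
      rw [interior_Ici] at hb
      have hb : b₂ < b := hb
      exact (hd b (by linarith)).differentiableAt.differentiableWithinAt
    · intro b hb
      rw [interior_Ici] at hb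
      have hb : b₂ < b := hb
      have hb0 : 0 < b := by linarith
      rw [(hd b hb0.le).deriv]
      have h1 := hmono hm3 (hm3.trans hb.le) hb.le
      have h2 : 0 < hypSlope m b := pos_of_mul_pos_right (hN₂.trans_le h1) (hpos hb0).le
      exact (mul_pos (hfac b hb0) h2).le
  exact hmonor hb₂.2.le (hb₂.2.le.trans hb) hb

/-- Substitution `y = (k + t)^2` in the total mass for `κ = k^2`. The variable `t = √y - k` is the
one with a Gaussian limit of fixed width as `k → ∞`. -/
theorem lintegral_ncDensity_sqrt {m : ℝ} (hm : 0 < m) (k : ℝ) :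
    ∫⁻ t, (Set.Ioi (-k)).indicator
      (fun t => ENNReal.ofReal (2 * (k + t) * ncDensity m (k ^ 2) ((k + t) ^ 2))) t = 1 := by
  have himg : (fun t : ℝ => (k + t) ^ 2) '' Set.Ioi (-k) = Set.Ioi 0 := by
    ext y
    constructor
    · rintro ⟨t, ht, rfl⟩
      have ht : -k < t := ht
      have : 0 < k + t := by linarith
      exact pow_pos this 2
    · intro hy
      have hy : 0 < y := hy
      refine ⟨Real.sqrt y - k, ?_, ?_⟩
      · have := Real.sqrt_pos.2 hy
        show -k < Real.sqrt y - k
        linarith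
      · simp [Real.sq_sqrt hy.le]
  have hinj : Set.InjOn (fun t : ℝ => (k + t) ^ 2) (Set.Ioi (-k)) := by
    intro a ha b hb hab
    have ha : -k < a := ha
    have hb : -k < b := hb
    have := (sq_eq_sq₀ (by linarith : 0 ≤ k + a) (by linarith : 0 ≤ k + b)).1 hab
    linarith
  have hder : ∀ t ∈ Set.Ioi (-k), HasDerivWithinAt (fun t : ℝ => (k + t) ^ 2) (2 * (k + t))
      (Set.Ioi (-k)) t := by
    intro t _
    have := (((hasDerivAt_id t).const_add k).pow 2)
    refine (this.congr_deriv ?_).hasDerivWithinAt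
    simp
  have h := lintegral_image_eq_lintegral_abs_deriv_mul measurableSet_Ioi hder hinj
    (fun y => ENNReal.ofReal (ncDensity m (k ^ 2) y))
  rw [himg, lintegral_ncDensity hm (sq_nonneg k)] at h
  rw [lintegral_indicator measurableSet_Ioi, h]
  refine setLIntegral_congr_fun measurableSet_Ioi fun t ht => ?_
  have ht : -k < t := ht
  have : 0 < k + t := by linarith
  show ENNReal.ofReal _ = ENNReal.ofReal _ * ENNReal.ofReal _
  rw [← ENNReal.ofReal_mul (abs_nonneg _), abs_of_pos (by positivity)]

/-- The leading term of `2 v * ncDensity m (k ^ 2) (v ^ 2)` tends to a Gaussian density. -/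
theorem tendsto_gaussian_limit (m t : ℝ) :
    Tendsto (fun k : ℕ =>
      Real.exp (-t ^ 2) * Real.exp (Real.sqrt (m ^ 2 + 4 * (k * (k + t)) ^ 2) - 2 * (k * (k + t))) *
        ((m + Real.sqrt (m ^ 2 + 4 * (k * (k + t)) ^ 2)) / 2 / (k + t) ^ 2) ^ (1 - m) *
        (2 / Real.sqrt (2 * Real.pi * (Real.sqrt (m ^ 2 + 4 * (k * (k + t)) ^ 2) / (k + t) ^ 2))))
      atTop (𝓝 (Real.exp (-t ^ 2) / Real.sqrt Real.pi)) := by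
  set s : ℕ → ℝ := fun k => Real.sqrt (m ^ 2 + 4 * (k * (k + t)) ^ 2) with hs
  have hk : Tendsto (fun k : ℕ => (k : ℝ)) atTop atTop := tendsto_natCast_atTop_atTop
  have hv : Tendsto (fun k : ℕ => (k : ℝ) + t) atTop atTop := tendsto_atTop_add_const_right _ _ hk
  have hvinv : Tendsto (fun k : ℕ => ((k : ℝ) + t)⁻¹) atTop (𝓝 0) := tendsto_inv_atTop_zero.comp hv
  have hvpos : ∀ᶠ k : ℕ in atTop, 0 < (k : ℝ) + t := hv.eventually_gt_atTop 0
  have hkv : Tendsto (fun k : ℕ => (k : ℝ) / (k + t)) atTop (𝓝 1) := by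
    have : Tendsto (fun k : ℕ => 1 - t * ((k : ℝ) + t)⁻¹) atTop (𝓝 1) := by
      simpa using (hvinv.const_mul t).const_sub 1
    refine this.congr' ?_
    filter_upwards [hvpos] with k hk
    field_simp
    ring
  have hx : Tendsto (fun k : ℕ => (k : ℝ) * (k + t)) atTop atTop := hk.atTop_mul_atTop₀ hv
  have hr : Tendsto (fun k => s k / ((k : ℝ) + t) ^ 2) atTop (𝓝 2) := by
    have h1 : Tendsto (fun k : ℕ => Real.sqrt (m ^ 2 * (((k : ℝ) + t)⁻¹) ^ 4
        + 4 * ((k : ℝ) / (k + t)) ^ 2)) atTop (𝓝 (Real.sqrt (m ^ 2 * 0 ^ 4 + 4 * 1 ^ 2))) :=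
      (((hvinv.pow 4).const_mul _).add ((hkv.pow 2).const_mul 4)).sqrt
    have e : Real.sqrt (m ^ 2 * 0 ^ 4 + 4 * 1 ^ 2) = 2 := by
      rw [show (m ^ 2 * 0 ^ 4 + 4 * 1 ^ 2 : ℝ) = 2 ^ 2 by ring, Real.sqrt_sq (by norm_num)]
    rw [e] at h1
    refine h1.congr' ?_
    filter_upwards [hvpos] with k hk
    rw [eq_div_iff (by positivity), ← Real.sqrt_sq (show 0 ≤ ((k : ℝ) + t) ^ 2 by positivity),
      ← Real.sqrt_mul (by positivity), hs]
    congr 1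
    field_simp
  have hA : Tendsto (fun k => (m + s k) / 2 / ((k : ℝ) + t) ^ 2) atTop (𝓝 1) := by
    have : Tendsto (fun k : ℕ => (m * (((k : ℝ) + t)⁻¹) ^ 2 + s k / ((k : ℝ) + t) ^ 2) / 2) atTop
        (𝓝 ((m * 0 ^ 2 + 2) / 2)) :=
      (((hvinv.pow 2).const_mul m).add hr).div_const 2
    rw [show (m * 0 ^ 2 + 2) / 2 = (1 : ℝ) by norm_num] at this
    refine this.congr' ?_
    filter_upwards [hvpos] with k hk
    field_simp
  have hE : Tendsto (fun k : ℕ => s k - 2 * (k * (k + t))) atTop (𝓝 0) := by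
    have h1 : Tendsto (fun k : ℕ => m ^ 2 * ((k : ℝ) * (k + t))⁻¹) atTop (𝓝 0) := by
      simpa using (tendsto_inv_atTop_zero.comp hx).const_mul (m ^ 2)
    refine tendsto_of_tendsto_of_tendsto_of_le_of_le' tendsto_const_nhds h1 ?_ ?_
    · filter_upwards [hx.eventually_gt_atTop 0] with k hk
      have : 2 * ((k : ℝ) * (k + t)) ≤ s k := Real.le_sqrt_of_sq_le (by nlinarith [sq_nonneg m])
      linarith
    · filter_upwards [hx.eventually_gt_atTop 0] with k hk
      rw [sub_le_iff_le_add]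
      refine Real.sqrt_le_iff.2 ⟨by positivity, ?_⟩
      set x := (k : ℝ) * (k + t)
      have e : (m ^ 2 * x⁻¹ + 2 * x) ^ 2 = (m ^ 2 * x⁻¹) ^ 2 + 4 * m ^ 2 + 4 * x ^ 2 := by
        field_simp
        ring
      rw [e]
      nlinarith [sq_nonneg (m ^ 2 * x⁻¹), sq_nonneg m]
  have h4 : Real.sqrt (2 * Real.pi * 2) = 2 * Real.sqrt Real.pi := by
    rw [show 2 * Real.pi * 2 = 2 ^ 2 * Real.pi by ring, Real.sqrt_mul (by positivity),
      Real.sqrt_sq (by norm_num)]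
  have hπ := Real.sqrt_pos.2 Real.pi_pos
  have := ((((Real.continuous_exp.tendsto 0).comp hE).const_mul (Real.exp (-t ^ 2))).mul
    (hA.rpow_const (p := 1 - m) (Or.inl one_ne_zero))).mul
    ((tendsto_const_nhds (x := (2 : ℝ))).div ((hr.const_mul (2 * Real.pi)).sqrt)
      (by rw [h4]; positivity))
  rw [h4, Real.exp_zero, Real.one_rpow] at this
  rw [show Real.exp (-t ^ 2) * 1 * 1 * (2 / (2 * Real.sqrt Real.pi))
    = Real.exp (-t ^ 2) / Real.sqrt Real.pi by field_simp] at this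
  exact this

/-- The normalized function `hypRatio` is at most `1`: the local limit bound. -/
theorem hypRatio_le_one {m b : ℝ} (hm : 0 < m) (hb : 0 ≤ b) : hypRatio m b ≤ 1 := by
  by_contra! hlt
  set C := hypRatio m b with hC
  have hmono : ∀ b', b ≤ b' → C ≤ hypRatio m b' := fun b' hb' => hypRatio_le_of_one_lt hm hb hlt hb'
  set F : ℕ → ℝ → ENNReal := fun k => (Set.Ioi (-(k : ℝ))).indicator
      (fun t => ENNReal.ofReal (2 * (k + t) * ncDensity m ((k : ℝ) ^ 2) ((k + t) ^ 2))) with hF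
  have hFm : ∀ k, Measurable (F k) := fun k => by
    refine Measurable.indicator ?_ measurableSet_Ioi
    have := measurable_ncDensity hm ((k : ℝ) ^ 2)
    fun_prop
  -- Each `F k` has mass one, while its liminf will be at least `C` times a normalized Gaussian
  -- density; hence `C ≤ 1`.
  have hfatou : ∫⁻ t, liminf (fun k => F k t) atTop ≤ 1 := by
    refine (lintegral_liminf_le hFm).trans ?_
    simp_rw [hF, lintegral_ncDensity_sqrt hm]
    simp
  have hpt : ∀ t, ENNReal.ofReal (C * (Real.exp (-t ^ 2) / Real.sqrt Real.pi))
      ≤ liminf (fun k => F k t) atTop := by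
    intro t
    have hlim := (ENNReal.continuous_ofReal.tendsto _).comp
      ((tendsto_gaussian_limit m t).const_mul C)
    rw [← hlim.liminf_eq]
    refine liminf_le_liminf ?_
    have hk : Tendsto (fun k : ℕ => (k : ℝ)) atTop atTop := tendsto_natCast_atTop_atTop
    have hv : Tendsto (fun k : ℕ => (k : ℝ) + t) atTop atTop := tendsto_atTop_add_const_right _ _ hk
    have hx : Tendsto (fun k : ℕ => (k : ℝ) * (k + t)) atTop atTop := hk.atTop_mul_atTop₀ hv
    filter_upwards [hv.eventually_gt_atTop 0, hx.eventually_ge_atTop (b + m)] with k hv0 hxb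
    have hmem : t ∈ Set.Ioi (-(k : ℝ)) := by
      show -(k : ℝ) < t
      linarith
    simp only [hF, Set.indicator_of_mem hmem, Function.comp]
    refine ENNReal.ofReal_le_ofReal ?_
    set v := (k : ℝ) + t with hvdef
    set s := Real.sqrt (m ^ 2 + 4 * (k * v) ^ 2) with hs
    have hs2 : s ^ 2 = m ^ 2 + 4 * (k * v) ^ 2 := Real.sq_sqrt (by positivity)
    have hsx : 2 * (k * v) ≤ s := Real.le_sqrt_of_sq_le (by nlinarith [sq_nonneg m])
    have hs0 : 0 < s := by linarith
    -- The argument `b' = (s - m)/2` is the nonnegative root of `b'(b' + m) = (k v)^2`, the point at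
    -- which the density evaluates `hyp01`.
    have hR := hmono ((s - m) / 2) (by linarith)
    have hw : (s - m) / 2 * ((s - m) / 2 + m) = (k : ℝ) ^ 2 * v ^ 2 := by nlinarith
    have hA : (s - m) / 2 + m = (m + s) / 2 := by ring
    have hss : 2 * ((s - m) / 2) + m = s := by ring
    rw [hypRatio, hw, hA, hss] at hR
    have hA0 : 0 < (m + s) / 2 := by positivity
    set A := (m + s) / 2 with hAdef
    have hv2 : 0 < v ^ 2 := by positivity
    have hφ := hyp01_pos hm (w := (k : ℝ) ^ 2 * v ^ 2) (by positivity)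
    have e1 : (A / v ^ 2) ^ (1 - m) = (A ^ (m - 1))⁻¹ * (v ^ 2) ^ (m - 1) := by
      rw [show 1 - m = -(m - 1) by ring, Real.rpow_neg (by positivity),
        Real.div_rpow hA0.le hv2.le, inv_div, div_eq_inv_mul]
    have e2 : 2 / Real.sqrt (2 * Real.pi * (s / v ^ 2)) = 2 * v / Real.sqrt (2 * Real.pi * s) := by
      rw [← mul_div_assoc, Real.sqrt_div (by positivity), Real.sqrt_sq hv0.le]
      field_simp
    have e3 : Real.exp (-t ^ 2) * Real.exp (s - 2 * (k * v))
        = Real.exp (-v ^ 2 - k ^ 2) * Real.exp s := by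
      rw [← Real.exp_add, ← Real.exp_add, hvdef]
      ring_nf
    have hq : 0 < Real.sqrt (2 * Real.pi * s) := Real.sqrt_pos.2 (by positivity)
    have hAp : 0 < A ^ (m - 1) := Real.rpow_pos_of_pos hA0 _
    rw [e1, e2, e3, ncDensity]
    calc C * (Real.exp (-v ^ 2 - k ^ 2) * Real.exp s * ((A ^ (m - 1))⁻¹ * (v ^ 2) ^ (m - 1)) *
          (2 * v / Real.sqrt (2 * Real.pi * s)))
        = (Real.exp (-v ^ 2 - k ^ 2) * Real.exp s * ((A ^ (m - 1))⁻¹ * (v ^ 2) ^ (m - 1)) *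
          (2 * v / Real.sqrt (2 * Real.pi * s))) * C := by ring
      _ ≤ (Real.exp (-v ^ 2 - k ^ 2) * Real.exp s * ((A ^ (m - 1))⁻¹ * (v ^ 2) ^ (m - 1)) *
          (2 * v / Real.sqrt (2 * Real.pi * s))) * _ :=
          mul_le_mul_of_nonneg_left hR (by positivity)
      _ = 2 * v * (Real.exp (-v ^ 2 - k ^ 2) * (v ^ 2) ^ (m - 1) *
          hyp01 m ((k : ℝ) ^ 2 * v ^ 2)) := by
          rw [Real.exp_neg]
          field_simp
  have hint : ∫⁻ t, ENNReal.ofReal (C * (Real.exp (-t ^ 2) / Real.sqrt Real.pi))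
      = ENNReal.ofReal C := by
    have hg := integral_gaussian 1
    have hgi := integrable_exp_neg_mul_sq (b := 1) one_pos
    simp only [div_one, neg_mul, one_mul] at hg hgi
    rw [← ofReal_integral_eq_lintegral_ofReal ((hgi.div_const _).const_mul _)
      (ae_of_all _ fun t => mul_nonneg (by linarith) (by positivity)), integral_const_mul,
      integral_div, hg, div_self (Real.sqrt_pos.2 Real.pi_pos).ne', mul_one]
  have := (lintegral_mono hpt).trans hfatou
  rw [hint, ENNReal.ofReal_le_one] at this
  linarith

/-! ### Tail bounds for the noncentral chi-squared law -/

theorem integrableOn_ncDensity {m κ : ℝ} (hm : 0 < m) (hκ : 0 ≤ κ) :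
    IntegrableOn (ncDensity m κ) (Set.Ioi 0) := by
  refine ⟨(measurable_ncDensity hm κ).aestronglyMeasurable, ?_⟩
  rw [hasFiniteIntegral_iff_ofReal, lintegral_ncDensity hm hκ]
  · exact ENNReal.one_lt_top
  · filter_upwards [ae_restrict_mem measurableSet_Ioi] with y hy
    exact (ncDensity_pos hm hκ hy).le

theorem ncMeasure_real {m κ : ℝ} (hm : 0 < m) (hκ : 0 ≤ κ) {S : Set ℝ} (hS : MeasurableSet S) :
    (ncMeasure m κ).real S = ∫ y in S ∩ Set.Ioi 0, ncDensity m κ y := by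
  rw [Measure.real, ncMeasure, withDensity_apply _ hS, Measure.restrict_restrict hS,
    integral_eq_lintegral_of_nonneg_ae _ (measurable_ncDensity hm κ).aestronglyMeasurable]
  filter_upwards [ae_restrict_mem (hS.inter measurableSet_Ioi)] with y hy
  exact (ncDensity_pos hm hκ hy.2).le

theorem ncMeasure_real_Ioc_pos {m κ : ℝ} (hm : 0 < m) (hκ : 0 ≤ κ) {a b : ℝ} (hab : a < b)
    (hb : 0 < b) : 0 < (ncMeasure m κ).real (Set.Ioc a b) := by
  have hset : Set.Ioc a b ∩ Set.Ioi 0 = Set.Ioc (max a 0) b := by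
    rw [Set.Ioc_inter_Ioi]
  have hlt : max a 0 < b := max_lt hab hb
  have h0 : (0 : ℝ) ≤ max a 0 := le_max_right _ _
  rw [ncMeasure_real hm hκ measurableSet_Ioc, hset, ← intervalIntegral.integral_of_le hlt.le]
  refine intervalIntegral.intervalIntegral_pos_of_pos_on ?_ (fun y hy => ?_) hlt
  · rw [intervalIntegrable_iff_integrableOn_Ioc_of_le hlt.le]
    exact (integrableOn_ncDensity hm hκ).mono_set fun y hy => lt_of_le_of_lt h0 hy.1
  · exact ncDensity_pos hm hκ (h0.trans_lt hy.1)

theorem hasDerivAt_ncDensity {m κ y : ℝ} (hm : 0 < m) (hy : 0 < y) :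
    HasDerivAt (ncDensity m κ) (Real.exp (-y - κ) * y ^ (m - 1) *
      (((m - 1) / y - 1) * hyp01 m (κ * y) + κ * hyp01 (m + 1) (κ * y))) y := by
  have h1 : HasDerivAt (fun y => Real.exp (-y - κ)) (Real.exp (-y - κ) * -1) y :=
    ((hasDerivAt_id y).neg.sub_const κ).exp
  have h2 := Real.hasDerivAt_rpow_const (x := y) (p := m - 1) (Or.inl hy.ne')
  have h3 : HasDerivAt (fun y => hyp01 m (κ * y)) (hyp01 (m + 1) (κ * y) * (κ * 1)) y :=
    (hasDerivAt_hyp01 hm (κ * y)).comp y ((hasDerivAt_id y).const_mul κ)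
  refine ((h1.mul h2).mul h3).congr_deriv ?_
  have e : y ^ (m - 1) = y ^ (m - 1 - 1) * y := by
    rw [← Real.rpow_add_one hy.ne']
    ring_nf
  simp only [Pi.mul_apply]
  rw [e]
  field_simp
  ring

/-- Iterating this relation expands the lower tail into the sum of `ncDensity (m + j)` over `j ≥ 1`,
the series behind the lower-tail bound. -/
theorem hasDerivAt_ncDensity_add_one {m κ y : ℝ} (hm : 0 < m) (hy : 0 < y) :
    HasDerivAt (ncDensity (m + 1) κ) (ncDensity m κ y - ncDensity (m + 1) κ y) y := by
  refine (hasDerivAt_ncDensity (m := m + 1) (by linarith) hy).congr_deriv ?_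
  have hr := hyp01_recurrence hm (κ * y)
  rw [ncDensity, ncDensity, hr]
  have e : y ^ (m + 1 - 1) = y ^ (m - 1) * y := by
    rw [← Real.rpow_add_one hy.ne']
    ring_nf
  rw [e, show m + 1 + 1 = m + 2 by ring]
  field_simp
  ring

theorem continuousOn_ncDensity {m κ : ℝ} (hm : 0 < m) :
    ContinuousOn (ncDensity m κ) (Set.Ioi 0) := fun _ hy =>
  (hasDerivAt_ncDensity hm hy).continuousAt.continuousWithinAt

theorem continuous_ncDensity_add_one {m κ : ℝ} (hm : 0 < m) :
    Continuous (ncDensity (m + 1) κ) := by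
  have h1 := continuous_hyp01 (m := m + 1) (by linarith)
  have h2 : Continuous fun y : ℝ => y ^ (m + 1 - 1) :=
    Real.continuous_rpow_const (by linarith)
  unfold ncDensity
  fun_prop

/-- Geometric upper-tail bound. -/
theorem ncMeasure_real_Ioi_le {m κ y₀ b : ℝ} (hm : 1 / 2 ≤ m) (hκ : 0 < κ) (hb : 0 ≤ b)
    (hw : b * (b + m) = κ * y₀) (hlt : b + m < y₀) :
    (ncMeasure m κ).real (Set.Ioi y₀) ≤ ncDensity m κ y₀ / (1 - (b + m) / y₀) := by
  have hm0 : 0 < m := by linarith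
  have hy₀ : 0 < y₀ := by linarith
  set ρ := (b + m) / y₀ with hρ
  have hρy : ρ * y₀ = b + m := div_mul_cancel₀ _ hy₀.ne'
  have hρ0 : 0 < ρ := by positivity
  have hρ1 : ρ < 1 := (div_lt_one hy₀).2 hlt
  have hsub : Set.Ioi y₀ ⊆ Set.Ioi (0 : ℝ) := Set.Ioi_subset_Ioi hy₀.le
  have hint := (integrableOn_ncDensity hm0 hκ.le).mono_set hsub
  rw [ncMeasure_real hm0 hκ.le measurableSet_Ioi, Set.inter_eq_left.2 hsub]
  refine le_of_tendsto (intervalIntegral_tendsto_integral_Ioi y₀ hint tendsto_id) ?_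
  filter_upwards [eventually_ge_atTop y₀] with T hT
  have hT0 : 0 < T := hy₀.trans_le hT
  -- Beyond `y₀` the logarithmic derivative of the density is at most `ρ - 1`, so `-ncDensity/(1 -
  -- ρ)` grows at least as fast as the integral.
  have key : ∫ y in y₀..T, ncDensity m κ y
      ≤ -(ncDensity m κ T / (1 - ρ)) - -(ncDensity m κ y₀ / (1 - ρ)) := by
    refine intervalIntegral.integral_le_sub_of_hasDeriv_right_of_le
      (g := fun y => -(ncDensity m κ y / (1 - ρ))) hT ?_
      (fun y hy => ((hasDerivAt_ncDensity hm0 (hy₀.trans hy.1)).div_const _).neg.hasDerivWithinAt)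
      ?_ ?_
    · exact (((continuousOn_ncDensity hm0).mono fun y hy => hy₀.trans_le hy.1).div_const _).neg
    · exact ((continuousOn_ncDensity hm0).mono fun y hy => hy₀.trans_le hy.1).integrableOn_Icc
    · intro y hy
      have hyy : y₀ < y := hy.1
      have hy0 : 0 < y := hy₀.trans hyy
      have hw0 : 0 < κ * y := by positivity
      have hf := hyp01_pos hm0 hw0.le
      have hg := hyp01_pos (m := m + 1) (by linarith) hw0.le
      have ham := hyp01_amos hm hw0.le
      have hE : 0 < Real.exp (-y - κ) * y ^ (m - 1) :=
        mul_pos (Real.exp_pos _) (Real.rpow_pos_of_pos hy0 _)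
      rw [ncDensity]
      set f := hyp01 m (κ * y)
      set g := hyp01 (m + 1) (κ * y)
      set E := Real.exp (-y - κ) * y ^ (m - 1)
      -- Otherwise Amos gives `(ρy - m + 1)(ρy + 1/2) ≤ κy`. The saddle relation gives `κ = ρ²y₀ -
      -- mρ ≤ ρ²y - mρ`, and these conflict since `ρy > m`.
      have hmain : κ * y * g ≤ (ρ * y - m + 1) * f := by
        by_contra! hcon
        have hx1 : m < ρ * y := by
          have := mul_lt_mul_of_pos_left hyy hρ0
          linarith
        have hquad : κ ≤ ρ ^ 2 * y - m * ρ := by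
          have h1 : κ = ρ ^ 2 * y₀ - m * ρ := by
            have : κ * y₀ = (ρ ^ 2 * y₀ - m * ρ) * y₀ := by
              rw [← hw]
              linear_combination (-b - ρ * y₀) * hρy
            exact mul_right_cancel₀ hy₀.ne' this
          have := mul_lt_mul_of_pos_left hyy (pow_pos hρ0 2)
          linarith
        have h2 : (κ * y * g) * (κ * y * g + (m - 1 / 2) * f) ≤ κ * y * f ^ 2 := by
          have := mul_nonneg hw0.le ham
          linarith
        have hX : 0 < (ρ * y - m + 1) * f := mul_pos (by linarith) hf
        have h3 : (ρ * y - m + 1) * f * ((ρ * y + 1 / 2) * f)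
            ≤ (κ * y * g) * (κ * y * g + (m - 1 / 2) * f) :=
          mul_le_mul hcon.le (by linarith) (by positivity) (by positivity)
        have h4 : (ρ * y - m + 1) * (ρ * y + 1 / 2) ≤ κ * y := by
          have : (ρ * y - m + 1) * (ρ * y + 1 / 2) * f ^ 2 ≤ κ * y * f ^ 2 := by linarith
          exact le_of_mul_le_mul_right this (by positivity)
        nlinarith [mul_le_mul_of_nonneg_right hquad hy0.le]
      have h5 : (m - 1) / y * f + κ * g ≤ ρ * f := by
        have : ((m - 1) / y * f + κ * g) * y ≤ (ρ * f) * y := by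
          have e : ((m - 1) / y * f + κ * g) * y = (m - 1) * f + κ * y * g := by
            field_simp
          rw [e]
          linarith
        exact le_of_mul_le_mul_right this hy0
      have h6 : E * ((1 - ρ) * f) ≤ -(E * (((m - 1) / y - 1) * f + κ * g)) := by
        rw [← mul_neg]
        exact mul_le_mul_of_nonneg_left (by linarith) hE.le
      rw [← neg_div, le_div_iff₀ (by linarith)]
      linarith
  have := ncDensity_pos hm0 hκ.le hT0
  have : 0 ≤ ncDensity m κ T / (1 - ρ) := div_nonneg this.le (by linarith)
  simp only [id]
  linarith

/-- Geometric lower-tail bound. -/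
theorem ncMeasure_real_Iic_le {m κ y₀ : ℝ} (hm : 1 / 2 ≤ m) (hκ : 0 < κ) (hy₀ : 0 < y₀)
    (hlt : y₀ * hyp01 (m + 2) (κ * y₀) < hyp01 (m + 1) (κ * y₀)) :
    (ncMeasure m κ).real (Set.Iic y₀)
      ≤ ncDensity (m + 1) κ y₀ /
        (1 - y₀ * hyp01 (m + 2) (κ * y₀) / hyp01 (m + 1) (κ * y₀)) := by
  have hm0 : 0 < m := by linarith
  have hm1 : 0 < m + 1 := by linarith
  have hp1 : ∀ {y : ℝ}, 0 ≤ y → 0 < hyp01 (m + 1) (κ * y) := fun hy =>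
    hyp01_pos hm1 (by positivity)
  set q : ℝ → ℝ := fun y => y * hyp01 (m + 2) (κ * y) / hyp01 (m + 1) (κ * y) with hq
  have hq1 : q y₀ < 1 := (div_lt_one (hp1 hy₀.le)).2 hlt
  have hdq : ∀ y, 0 ≤ y → HasDerivAt q
      ((hyp01 (m + 1) (κ * y) ^ 2 - m * hyp01 (m + 1) (κ * y) * hyp01 (m + 2) (κ * y)
        - κ * y * hyp01 (m + 2) (κ * y) ^ 2) / hyp01 (m + 1) (κ * y) ^ 2) y := by
    intro y hy
    have hl : HasDerivAt (fun y => κ * y) (κ * 1) y := (hasDerivAt_id y).const_mul κ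
    have h1 := (hasDerivAt_hyp01 hm1 (κ * y)).comp y hl
    have h2 := (hasDerivAt_hyp01 (m := m + 2) (by linarith) (κ * y)).comp y hl
    have := ((hasDerivAt_id y).mul h2).div h1 (hp1 hy).ne'
    refine this.congr_deriv ?_
    have hr := hyp01_recurrence hm1 (κ * y)
    rw [show m + 1 + 1 = m + 2 by ring, show m + 1 + 2 = m + 2 + 1 by ring] at hr
    simp only [Pi.mul_apply, Function.comp, id, show m + 1 + 1 = m + 2 by ring]
    congr 1
    linear_combination -hyp01 (m + 1) (κ * y) * hr
  -- The numerator of `q'` is the Amos expression for `m + 1` with coefficient `m` in place of `m +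
  -- 1/2`, hence nonnegative.
  have hqm : MonotoneOn q (Set.Ici 0) := by
    refine monotoneOn_of_deriv_nonneg (convex_Ici 0)
      (fun y hy => (hdq y hy).continuousAt.continuousWithinAt) ?_ ?_
    · intro y hy
      rw [interior_Ici] at hy
      exact (hdq y (le_of_lt hy)).differentiableAt.differentiableWithinAt
    · intro y hy
      rw [interior_Ici] at hy
      have hy : 0 < y := hy
      rw [(hdq y hy.le).deriv]
      have ham := hyp01_amos (m := m + 1) (by linarith) (w := κ * y) (by positivity)
      rw [show m + 1 + 1 = m + 2 by ring] at ham
      have h1 := hp1 hy.le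
      have h2 := hyp01_pos (m := m + 2) (by linarith) (w := κ * y) (by positivity)
      refine div_nonneg ?_ (by positivity)
      nlinarith [mul_pos h1 h2]
  rw [ncMeasure_real hm0 hκ.le measurableSet_Iic, Set.Iic_inter_Ioi,
    ← intervalIntegral.integral_of_le hy₀.le]
  -- First term of the series plus a geometric majorant of the rest. `G'` dominates the density
  -- because `ncDensity (m+2) ≤ q(y₀) ncDensity (m+1)` up to `y₀`; at `y₀` the two terms collapse to
  -- `ncDensity (m+1)/(1 - q(y₀))`.
  set G : ℝ → ℝ := fun y => ncDensity (m + 1) κ y + ncDensity (m + 1 + 1) κ y / (1 - q y₀) with hG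
  have hratio : ∀ y, 0 < y → ncDensity (m + 1 + 1) κ y = q y * ncDensity (m + 1) κ y := by
    intro y hy
    have e : y ^ (m + 1 + 1 - 1) = y ^ (m + 1 - 1) * y := by
      rw [← Real.rpow_add_one hy.ne']
      ring_nf
    have := (hp1 hy.le).ne'
    rw [ncDensity, ncDensity, e, show m + 1 + 1 = m + 2 by ring]
    simp only [hq]
    generalize hyp01 (m + 1) (κ * y) = f at this
    field_simp
  have key : ∫ y in (0 : ℝ)..y₀, ncDensity m κ y ≤ G y₀ - G 0 := by
    refine intervalIntegral.integral_le_sub_of_hasDeriv_right_of_le hy₀.le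
      ((continuous_ncDensity_add_one hm0).add
        ((continuous_ncDensity_add_one hm1).div_const _)).continuousOn
      (fun y hy => ((hasDerivAt_ncDensity_add_one hm0 hy.1).add
        ((hasDerivAt_ncDensity_add_one hm1 hy.1).div_const _)).hasDerivWithinAt) ?_ ?_
    · rw [integrableOn_Icc_iff_integrableOn_Ioc]
      exact (integrableOn_ncDensity hm0 hκ.le).mono_set fun y hy => hy.1
    · intro y hy
      have h1 := hqm hy.1.le hy₀.le hy.2.le
      have h2 := ncDensity_pos hm1 hκ.le hy.1
      have h3 : ncDensity (m + 1) κ y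
          ≤ (ncDensity (m + 1) κ y - ncDensity (m + 1 + 1) κ y) / (1 - q y₀) := by
        rw [le_div_iff₀ (by linarith), hratio y hy.1]
        nlinarith
      linarith
  have hG0 : G 0 = 0 := by
    simp [hG, ncDensity, Real.zero_rpow hm0.ne', Real.zero_rpow hm1.ne']
  refine key.trans_eq ?_
  have h1 : (1 - q y₀) ≠ 0 := by linarith
  rw [hG0, sub_zero, hG]
  simp only [hratio y₀ hy₀]
  rw [show y₀ * hyp01 (m + 2) (κ * y₀) / hyp01 (m + 1) (κ * y₀) = q y₀ from rfl]
  field_simp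
  ring

/-- Saddle-point upper-tail bound. -/
theorem ncMeasure_real_Ioi_le_saddle {m κ y₀ b : ℝ} (hm : 1 / 2 ≤ m) (hκ : 0 < κ) (hb : 0 ≤ b)
    (hw : b * (b + m) = κ * y₀) (hlt : b + m < y₀) :
    (ncMeasure m κ).real (Set.Ioi y₀) ≤ Real.exp (2 * b + m - y₀ - κ) * (y₀ / (b + m)) ^ (m - 1) /
      Real.sqrt (2 * Real.pi * (2 * b + m)) / (1 - (b + m) / y₀) := by
  have hm0 : 0 < m := by linarith
  have hy₀ : 0 < y₀ := by linarith
  have hA : 0 < b + m := by linarith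
  refine (ncMeasure_real_Ioi_le hm hκ hb hw hlt).trans ?_
  refine div_le_div_of_nonneg_right ?_ (sub_nonneg.2 ((div_lt_one hy₀).2 hlt).le)
  have hR := hypRatio_le_one hm0 hb
  rw [hypRatio, hw] at hR
  have hq : 0 < Real.sqrt (2 * Real.pi * (2 * b + m)) := Real.sqrt_pos.2 (by positivity)
  have hAp : 0 < (b + m) ^ (m - 1) := Real.rpow_pos_of_pos hA _
  have hyp : 0 < y₀ ^ (m - 1) := Real.rpow_pos_of_pos hy₀ _
  rw [le_div_iff₀ hq, ncDensity, Real.div_rpow hy₀.le hA.le, ← mul_div_assoc, le_div_iff₀ hAp,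
    show 2 * b + m - y₀ - κ = (-y₀ - κ) + (2 * b + m) by ring, Real.exp_add]
  rw [Real.exp_neg] at hR
  have hE := Real.exp_pos (2 * b + m)
  calc _ = Real.exp (-y₀ - κ) * y₀ ^ (m - 1) * Real.exp (2 * b + m) *
        (hyp01 m (κ * y₀) * (b + m) ^ (m - 1) * (Real.exp (2 * b + m))⁻¹ *
          Real.sqrt (2 * Real.pi * (2 * b + m))) := by field_simp
    _ ≤ Real.exp (-y₀ - κ) * y₀ ^ (m - 1) * Real.exp (2 * b + m) * 1 :=
        mul_le_mul_of_nonneg_left hR (by positivity)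
    _ = _ := by ring

/-- Saddle-point lower-tail bound. -/
theorem ncMeasure_real_Iic_le_saddle {m κ y₀ b : ℝ} (hm : 1 / 2 ≤ m) (hκ : 0 < κ) (hb : 0 < b)
    (hw : b * (b + m) = κ * y₀) (hle : b ≤ y₀) (hlt : y₀ < b + m) :
    (ncMeasure m κ).real (Set.Iic y₀) ≤ Real.exp (2 * b + m - y₀ - κ) * (y₀ / (b + m)) ^ m /
      Real.sqrt (2 * Real.pi * (2 * b + m)) / (1 - y₀ / (b + m)) := by
  have hm0 : 0 < m := by linarith
  have hy₀ : 0 < y₀ := by linarith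
  have hA : 0 < b + m := by linarith
  have hw0 : 0 < κ * y₀ := by positivity
  have hf := hyp01_pos (m := m + 1) (by linarith) hw0.le
  have hg := hyp01_pos (m := m + 2) (by linarith) hw0.le
  -- the ratio of contiguous functions is at most `1 / (b + m)`
  have hv : (b + m) * hyp01 (m + 2) (κ * y₀) ≤ hyp01 (m + 1) (κ * y₀) := by
    have ham := hyp01_amos (m := m + 1) (by linarith) hw0.le
    rw [show m + 1 + 1 = m + 2 by ring, ← hw] at ham
    rw [← hw] at hf hg ⊢
    by_contra! hcon
    set f := hyp01 (m + 1) (b * (b + m))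
    set g := hyp01 (m + 2) (b * (b + m))
    nlinarith [mul_pos hb hg, mul_pos hf hg, mul_pos hm0 hg,
      mul_lt_mul_of_pos_left hcon hf, mul_lt_mul_of_pos_left hcon (mul_pos hb hg)]
  have hlt' : y₀ * hyp01 (m + 2) (κ * y₀) < hyp01 (m + 1) (κ * y₀) :=
    (mul_lt_mul_of_pos_right hlt hg).trans_le hv
  refine (ncMeasure_real_Iic_le hm hκ hy₀ hlt').trans ?_
  -- The local bound concerns order `m`, the tail bound orders `m + 1` and `m + 2`; the recurrence
  -- translates between them.
  have hR := hypRatio_le_one hm0 hb.le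
  rw [hypRatio, hw, hyp01_recurrence hm0] at hR
  rw [ncDensity, show m + 1 - 1 = m by ring]
  set f := hyp01 (m + 1) (κ * y₀)
  set g := hyp01 (m + 2) (κ * y₀)
  have hq : 0 < Real.sqrt (2 * Real.pi * (2 * b + m)) := Real.sqrt_pos.2 (by positivity)
  set r := Real.sqrt (2 * Real.pi * (2 * b + m))
  have hAp : 0 < (b + m) ^ (m - 1) := Real.rpow_pos_of_pos hA _
  have e1 : (b + m) ^ m = (b + m) ^ (m - 1) * (b + m) := by
    rw [← Real.rpow_add_one hA.ne']
    ring_nf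
  have hyp : 0 < y₀ ^ m := Real.rpow_pos_of_pos hy₀ _
  have hE := Real.exp_pos (2 * b + m)
  rw [Real.div_rpow hy₀.le hA.le, e1,
    show 2 * b + m - y₀ - κ = (-y₀ - κ) + (2 * b + m) by ring, Real.exp_add]
  rw [Real.exp_neg] at hR
  set E := Real.exp (2 * b + m)
  set P := (b + m) ^ (m - 1)
  have hden : 0 < f - y₀ * g := by linarith
  -- the two geometric factors compare
  have hcmp : f ^ 2 * (b + m - y₀) ≤ (f - y₀ * g) * (m * f + κ * y₀ * g) := by
    rw [← hw]
    have h1 : 0 ≤ f - (b + m) * g := by linarith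
    -- The condition `b ≤ y₀` enters the comparison here. The factorization in `h4` reduces it to
    -- this and to `(b + m) g ≤ f`.
    have h2 : 0 ≤ b * (b + m) * y₀ * g + (b + m) * (y₀ - b) * f :=
      add_nonneg (by positivity) (mul_nonneg (mul_nonneg hA.le (by linarith)) hf.le)
    have h3 := mul_nonneg h1 h2
    have h4 : (f - (b + m) * g) * (b * (b + m) * y₀ * g + (b + m) * (y₀ - b) * f)
        = (b + m) * ((f - y₀ * g) * (m * f + b * (b + m) * g) - f ^ 2 * (b + m - y₀)) := by
      ring
    rw [h4] at h3
    have := nonneg_of_mul_nonneg_right h3 hA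
    linarith
  have hR' : (m * f + κ * y₀ * g) * P * r ≤ E := by
    have := mul_le_mul_of_nonneg_left hR hE.le
    have e : E * ((m * f + κ * y₀ * g) * P * E⁻¹ * r) = (m * f + κ * y₀ * g) * P * r := by
      field_simp
    linarith
  have hY := Real.exp_pos (-y₀ - κ)
  set Y := Real.exp (-y₀ - κ)
  have hAy : 0 < b + m - y₀ := by linarith
  have e2 : Y * y₀ ^ m * f / (1 - y₀ * g / f) = Y * y₀ ^ m * (f ^ 2 / (f - y₀ * g)) := by
    field_simp
  have e3 : Y * E * (y₀ ^ m / (P * (b + m))) / r / (1 - y₀ / (b + m))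
      = Y * y₀ ^ m * (E / (P * r * (b + m - y₀))) := by
    field_simp
  rw [e2, e3]
  refine mul_le_mul_of_nonneg_left ?_ (by positivity)
  rw [div_le_div_iff₀ hden (by positivity)]
  calc f ^ 2 * (P * r * (b + m - y₀)) = (f ^ 2 * (b + m - y₀)) * (P * r) := by ring
    _ ≤ ((f - y₀ * g) * (m * f + κ * y₀ * g)) * (P * r) :=
        mul_le_mul_of_nonneg_right hcmp (by positivity)
    _ = (f - y₀ * g) * ((m * f + κ * y₀ * g) * P * r) := by ring
    _ ≤ (f - y₀ * g) * E := mul_le_mul_of_nonneg_left hR' hden.le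
    _ = E * (f - y₀ * g) := by ring

/-! ### Error probabilities of the Neyman-Pearson test -/

theorem log_gaussianPDFReal (a y : ℝ) {v : NNReal} (hv : v ≠ 0) :
    Real.log (gaussianPDFReal a v y)
      = -(1 / 2 * Real.log (2 * Real.pi * v)) - (y - a) ^ 2 / (2 * v) := by
  have hv0 : (0 : ℝ) < v := lt_of_le_of_ne v.2 (fun h => hv (NNReal.coe_eq_zero.1 h.symm))
  rw [gaussianPDFReal, Real.log_mul (by positivity) (Real.exp_pos _).ne', Real.log_exp,
    Real.log_inv, Real.log_sqrt (by positivity)]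
  ring

theorem snr_pos {σx σw : ℝ} (hσx : 0 < σx) (hσw : 0 < σw) : 0 < snr σx σw := by
  unfold snr
  positivity

theorem coe_noiseVar (σw : ℝ) : (noiseVar σw : ℝ) = σw ^ 2 := Real.coe_toNNReal _ (sq_nonneg _)

theorem coe_outputVar (σx σw : ℝ) : (outputVar σx σw : ℝ) = σx ^ 2 + σw ^ 2 :=
  Real.coe_toNNReal _ (by positivity)

theorem noiseVar_ne_zero {σw : ℝ} (hσw : 0 < σw) : noiseVar σw ≠ 0 := by
  rw [← NNReal.coe_ne_zero, coe_noiseVar]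
  positivity

theorem outputVar_ne_zero {σx σw : ℝ} (hσw : 0 < σw) : outputVar σx σw ≠ 0 := by
  rw [← NNReal.coe_ne_zero, coe_outputVar]
  positivity

/-- The log-likelihood ratio is a decreasing function of the distance to a fixed point. -/
theorem logLikelihood_eq {n : ℕ} (hn : 0 < n) {σx σw : ℝ} (hσx : 0 < σx) (hσw : 0 < σw)
    {x : Fin n → ℝ} (hx : ∑ i, x i ^ 2 = n * σx ^ 2) (y : Fin n → ℝ) :
    logLikelihood σx σw x y = (1 + Real.log (1 + snr σx σw)) / 2
      - 1 / n * ∑ i, (y i - x i * ((σx ^ 2 + σw ^ 2) / σx ^ 2)) ^ 2 *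
        (σx ^ 2 / (2 * σw ^ 2 * (σx ^ 2 + σw ^ 2))) := by
  have hn0 : (0 : ℝ) < n := by exact_mod_cast hn
  have hv := noiseVar_ne_zero hσw
  have hu := outputVar_ne_zero (σx := σx) hσw
  have hp : ∀ (a : Fin n → ℝ) {v : NNReal}, v ≠ 0 → ∀ i, gaussianPDFReal (a i) v (y i) ≠ 0 :=
    fun a v hv i => (gaussianPDFReal_pos _ _ _ hv).ne'
  have hlog : Real.log (1 + snr σx σw)
      = Real.log (2 * Real.pi * (σx ^ 2 + σw ^ 2)) - Real.log (2 * Real.pi * σw ^ 2) := by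
    rw [← Real.log_div (by positivity) (by positivity), snr]
    congr 1
    field_simp
    ring
  rw [logLikelihood, gaussianDensity, gaussianDensity,
    Real.log_div (Finset.prod_ne_zero_iff.2 fun i _ => hp x hv i)
      (Finset.prod_ne_zero_iff.2 fun i _ => hp 0 hu i),
    Real.log_prod fun i _ => hp x hv i, Real.log_prod fun i _ => hp 0 hu i,
    ← Finset.sum_sub_distrib]
  -- Completing the square puts the centre at `x σy²/σx²`. The leftover `x i ^ 2 / (2 σx²)` sums to
  -- `n/2`, the source of the constant `1` in the threshold formula.
  have e : ∀ i, Real.log (gaussianPDFReal (x i) (noiseVar σw) (y i))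
      - Real.log (gaussianPDFReal ((0 : Fin n → ℝ) i) (outputVar σx σw) (y i))
      = (1 / 2 * Real.log (1 + snr σx σw) + x i ^ 2 * (1 / (2 * σx ^ 2)))
        - (y i - x i * ((σx ^ 2 + σw ^ 2) / σx ^ 2)) ^ 2 *
        (σx ^ 2 / (2 * σw ^ 2 * (σx ^ 2 + σw ^ 2))) := by
    intro i
    rw [log_gaussianPDFReal _ _ hv, log_gaussianPDFReal _ _ hu, coe_noiseVar, coe_outputVar, hlog,
      Pi.zero_apply]
    field_simp
    ring
  simp_rw [e]
  have hs : ∑ i, x i ^ 2 * (1 / (2 * σx ^ 2)) = n * σx ^ 2 * (1 / (2 * σx ^ 2)) := by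
    rw [← Finset.sum_mul, hx]
  rw [Finset.sum_sub_distrib, Finset.sum_add_distrib, hs, Finset.sum_const,
    Finset.card_univ, Fintype.card_fin, nsmul_eq_mul]
  generalize ∑ i, (y i - x i * ((σx ^ 2 + σw ^ 2) / σx ^ 2)) ^ 2 *
    (σx ^ 2 / (2 * σw ^ 2 * (σx ^ 2 + σw ^ 2))) = S
  field_simp
  ring

/-- The threshold for the squared distance which corresponds to the threshold `lam` for the
log-likelihood ratio. -/
noncomputable def distThreshold (n : ℕ) (Ω lam : ℝ) : ℝ :=
  (1 + Real.log (1 + Ω) - 2 * lam) * ((1 + Ω) * n / (2 * Ω))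

/-- The mean `x` differs from the centre by `x σw²/σx²`, which yields the noncentrality `n/(2Ω)`.
Small likelihood means large distance, hence an upper tail. -/
theorem pMD_eq {n : ℕ} (hn : 0 < n) {σx σw : ℝ} (hσx : 0 < σx) (hσw : 0 < σw)
    {x : Fin n → ℝ} (hx : ∑ i, x i ^ 2 = n * σx ^ 2) (lam : ℝ) :
    pMD σx σw x lam = (ncMeasure ((n : ℝ) / 2) (n / (2 * snr σx σw))).real
      (Set.Ioi (distThreshold n (snr σx σw) lam)) := by
  have hn0 : (0 : ℝ) < n := by exact_mod_cast hn
  set c : Fin n → ℝ := fun i => x i * ((σx ^ 2 + σw ^ 2) / σx ^ 2) with hc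
  have hmap := map_gaussianLaw_dist_sq hn x c (noiseVar_ne_zero hσw)
  have hκ : ∑ i, (x i - c i) ^ 2 / (2 * (noiseVar σw : ℝ)) = n / (2 * snr σx σw) := by
    have : ∀ i, (x i - c i) ^ 2 / (2 * (noiseVar σw : ℝ)) = x i ^ 2 * (σw ^ 2 / (2 * σx ^ 4)) := by
      intro i
      rw [coe_noiseVar, hc]
      field_simp
      ring
    simp_rw [this]
    rw [← Finset.sum_mul, hx, snr]
    field_simp
  rw [← hκ, ← hmap, map_measureReal_apply (by fun_prop) measurableSet_Ioi, pMD]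
  congr 1
  ext y
  rw [Set.mem_ofPred_eq, Set.mem_preimage, Set.mem_Ioi, logLikelihood_eq hn hσx hσw hx]
  have e : ∑ i, (y i - c i) ^ 2 * (σx ^ 2 / (2 * σw ^ 2 * (σx ^ 2 + σw ^ 2)))
      = (∑ i, (y i - c i) ^ 2 / (2 * (noiseVar σw : ℝ))) * (σx ^ 2 / (σx ^ 2 + σw ^ 2)) := by
    rw [Finset.sum_mul]
    refine Finset.sum_congr rfl fun i _ => ?_
    rw [coe_noiseVar]
    field_simp
  rw [e, distThreshold]
  set X := ∑ i, (y i - c i) ^ 2 / (2 * (noiseVar σw : ℝ))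
  have e2 : (1 + snr σx σw) * n / (2 * snr σx σw)
      = n * ((σx ^ 2 + σw ^ 2) / σx ^ 2) / 2 := by
    rw [snr]
    field_simp
    ring
  have e3 : 1 / (n : ℝ) * (X * (σx ^ 2 / (σx ^ 2 + σw ^ 2)))
      = X / (n * ((σx ^ 2 + σw ^ 2) / σx ^ 2)) := by
    field_simp
  have hk : 0 < n * ((σx ^ 2 + σw ^ 2) / σx ^ 2) := by positivity
  rw [e2, e3, sub_lt_comm, lt_div_iff₀ hk]
  constructor <;> intro h <;> linarith

/-- Here the mean is `0`, and the distance is normalized by the output variance, `1 + Ω` times the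
noise variance; this divides the cut by `1 + Ω`. -/
theorem pFA_eq {n : ℕ} (hn : 0 < n) {σx σw : ℝ} (hσx : 0 < σx) (hσw : 0 < σw)
    {x : Fin n → ℝ} (hx : ∑ i, x i ^ 2 = n * σx ^ 2) (lam : ℝ) :
    pFA σx σw x lam = (ncMeasure ((n : ℝ) / 2) (n * (1 + snr σx σw) / (2 * snr σx σw))).real
      (Set.Iic (distThreshold n (snr σx σw) lam / (1 + snr σx σw))) := by
  have hn0 : (0 : ℝ) < n := by exact_mod_cast hn
  set c : Fin n → ℝ := fun i => x i * ((σx ^ 2 + σw ^ 2) / σx ^ 2) with hc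
  have hmap := map_gaussianLaw_dist_sq hn 0 c (outputVar_ne_zero (σx := σx) hσw)
  have hκ : ∑ i, ((0 : Fin n → ℝ) i - c i) ^ 2 / (2 * (outputVar σx σw : ℝ))
      = n * (1 + snr σx σw) / (2 * snr σx σw) := by
    have : ∀ i, ((0 : Fin n → ℝ) i - c i) ^ 2 / (2 * (outputVar σx σw : ℝ))
        = x i ^ 2 * ((σx ^ 2 + σw ^ 2) / (2 * σx ^ 4)) := by
      intro i
      rw [coe_outputVar, hc, Pi.zero_apply]
      field_simp
      ring
    simp_rw [this]
    rw [← Finset.sum_mul, hx, snr]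
    field_simp
    ring
  rw [← hκ, ← hmap, map_measureReal_apply (by fun_prop) measurableSet_Iic, pFA]
  congr 1
  ext y
  rw [Set.mem_ofPred_eq, Set.mem_preimage, Set.mem_Iic, logLikelihood_eq hn hσx hσw hx]
  have e : ∑ i, (y i - c i) ^ 2 * (σx ^ 2 / (2 * σw ^ 2 * (σx ^ 2 + σw ^ 2)))
      = (∑ i, (y i - c i) ^ 2 / (2 * (outputVar σx σw : ℝ))) * (σx ^ 2 / σw ^ 2) := by
    rw [Finset.sum_mul]
    refine Finset.sum_congr rfl fun i _ => ?_
    rw [coe_outputVar]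
    field_simp
  have hΩ := snr_pos hσx hσw
  rw [e, distThreshold, ← snr]
  set X := ∑ i, (y i - c i) ^ 2 / (2 * (outputVar σx σw : ℝ))
  set Ω := snr σx σw
  have e2 : (1 + Real.log (1 + Ω) - 2 * lam) * ((1 + Ω) * n / (2 * Ω)) / (1 + Ω)
      = ((1 + Real.log (1 + Ω)) / 2 - lam) * n / Ω := by
    field_simp
  have e3 : 1 / (n : ℝ) * (X * Ω) = X * Ω / n := by ring
  rw [e2, e3, le_sub_comm, div_le_iff₀ hn0, le_div_iff₀ hΩ]

/-! ### The leading coefficient of the expansion -/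

theorem isSaddleMap_saddleMap (γ : ℝ) : IsSaddleMap γ (saddleMap γ) :=
  (exists_isSaddleMap γ).choose_spec

/-- Differentiating `u² = 2 α(log t)` twice at the critical point gives `1 = -cosh γ ·
(t'(0)/e^γ)²`. The sign condition on the imaginary part picks one of the two roots. -/
theorem IsSaddleMap.deriv_zero {γ : ℝ} {t : ℂ → ℂ} (h : IsSaddleMap γ t) :
    deriv t 0 = ((Real.exp γ / Real.sqrt (Real.cosh γ) : ℝ) : ℂ) * Complex.I := by
  obtain ⟨hta, ht0, htim, hteq⟩ := h
  have hc : 0 < Real.cosh γ := Real.cosh_pos γ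
  set W : ℂ → ℂ := fun u => Complex.log (t u) with hW
  have hslit : t 0 ∈ Complex.slitPlane := by
    rw [ht0, ← Complex.ofReal_exp]
    exact Complex.ofReal_mem_slitPlane.2 (Real.exp_pos γ)
  have hWa : AnalyticAt ℂ W 0 := hta.clog hslit
  have hW0 : W 0 = γ := by
    simp only [hW, ht0, ← Complex.ofReal_exp, ← Complex.ofReal_log (Real.exp_pos γ).le,
      Real.log_exp]
  have hdα : ∀ w, HasDerivAt (alpha γ) (Complex.sinh γ - Complex.sinh w) w := by
    intro w
    refine (((Complex.hasDerivAt_cosh w).const_sub (Complex.cosh γ)).add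
      (((hasDerivAt_id w).sub_const (γ : ℂ)).const_mul (Complex.sinh γ))).congr_deriv ?_
    ring
  -- the derivative of the defining equation
  have hd1 : ∀ᶠ u in 𝓝 (0 : ℂ), u = (Complex.sinh γ - Complex.sinh (W u)) * deriv W u := by
    filter_upwards [hteq.eventually_nhds, hWa.eventually_analyticAt] with u hu hWu
    have h1 : HasDerivAt (fun u : ℂ => u ^ 2) (2 * u) u := by
      simpa using hasDerivAt_pow 2 u
    have h2 : HasDerivAt (fun u => 2 * alpha γ (W u))
        (2 * ((Complex.sinh γ - Complex.sinh (W u)) * deriv W u)) u :=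
      ((hdα (W u)).comp u hWu.differentiableAt.hasDerivAt).const_mul 2
    have h3 := h1.unique (h2.congr_of_eventuallyEq hu)
    exact mul_left_cancel₀ two_ne_zero h3
  have hWd := hWa.differentiableAt.hasDerivAt
  have h2 := (((Complex.hasDerivAt_sinh (W 0)).comp (0 : ℂ) hWd).const_sub (Complex.sinh γ)).mul
    hWa.deriv.differentiableAt.hasDerivAt
  have h3 := (hasDerivAt_id (0 : ℂ)).unique (h2.congr_of_eventuallyEq hd1)
  simp only [Function.comp, hW0, sub_self, zero_mul, add_zero] at h3
  -- relation with the derivative of `t`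
  have hWt : deriv W 0 = deriv t 0 / Complex.exp γ := by
    rw [← ht0]
    exact (hta.differentiableAt.hasDerivAt.clog hslit).deriv
  have hE : Complex.exp γ ≠ 0 := Complex.exp_ne_zero _
  have hsq : (deriv t 0) ^ 2 * Complex.cosh γ = -Complex.exp γ ^ 2 := by
    rw [hWt] at h3
    field_simp at h3
    linear_combination h3
  set r : ℝ := Real.exp γ / Real.sqrt (Real.cosh γ) with hr
  have hr0 : 0 < r := div_pos (Real.exp_pos γ) (Real.sqrt_pos.2 hc)
  have hr2 : r ^ 2 * Real.cosh γ = Real.exp γ ^ 2 := by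
    rw [hr, div_pow, Real.sq_sqrt hc.le]
    field_simp
  have hcC : (Real.cosh γ : ℂ) ≠ 0 := by exact_mod_cast hc.ne'
  have hr2C : (r : ℂ) ^ 2 * Real.cosh γ = Complex.exp γ ^ 2 := by
    rw [← Complex.ofReal_exp]
    exact_mod_cast hr2
  have hfac : (deriv t 0 - r * Complex.I) * (deriv t 0 + r * Complex.I) = 0 := by
    rw [← Complex.ofReal_cosh] at hsq
    refine mul_right_cancel₀ hcC ?_
    linear_combination hsq + hr2C - (r : ℂ) ^ 2 * Real.cosh γ * Complex.I_sq
  rcases mul_eq_zero.1 hfac with h | h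
  · exact sub_eq_zero.1 h
  · exfalso
    rw [eq_neg_of_add_eq_zero_left h] at htim
    simp at htim
    linarith

theorem coeff_zero (γ θ : ℝ) :
    coeff γ θ 0 = Real.exp γ / (Real.sqrt (Real.cosh γ) * (Real.exp θ - Real.exp γ)) := by
  have h := isSaddleMap_saddleMap γ
  rw [coeff, iteratedDeriv_zero, integrand, h.deriv_zero, h.2.1, Nat.factorial_zero, Nat.cast_one,
    div_one]
  have e : ((Real.exp γ / Real.sqrt (Real.cosh γ) : ℝ) : ℂ) * Complex.I /
      (Complex.exp θ - Complex.exp γ) / Complex.I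
      = ((Real.exp γ / Real.sqrt (Real.cosh γ) / (Real.exp θ - Real.exp γ) : ℝ) : ℂ) := by
    push_cast
    have := Complex.I_ne_zero
    field_simp
  rw [e, Complex.ofReal_re, div_div]

theorem gTrunc_one {n : ℕ} {γ : ℝ} (hγ : 0 < γ) (θ : ℝ) :
    gTrunc n γ θ 1 = Real.sqrt (Real.tanh γ / (Real.pi * n)) * (Real.exp γ /
      (Real.exp θ - Real.exp γ)) := by
  have hS : 0 < Real.sinh γ := Real.sinh_pos_iff.2 hγ
  have hC : 0 < Real.cosh γ := Real.cosh_pos γ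
  have hG : Real.Gamma (1 / 2) ≠ 0 := (Real.Gamma_pos_of_pos (by norm_num)).ne'
  have e : Real.sqrt (Real.tanh γ / (Real.pi * n))
      = 1 / (2 * Real.sqrt Real.pi) * (1 / Real.sqrt (Real.cosh γ)) *
        Real.sqrt (4 * Real.sinh γ / n) := by
    have h4 : Real.sqrt 4 = 2 := by
      rw [show (4 : ℝ) = 2 ^ 2 by norm_num, Real.sqrt_sq (by norm_num)]
    rw [Real.tanh_eq_sinh_div_cosh, Real.sqrt_div (by positivity), Real.sqrt_div hS.le,
      Real.sqrt_mul Real.pi_pos.le, Real.sqrt_div (by positivity), Real.sqrt_mul (by norm_num), h4]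
    have := Real.sqrt_pos.2 Real.pi_pos
    field_simp
  rw [gTrunc, Finset.sum_range_one, mul_zero, coeff_zero, Nat.cast_zero, zero_add, div_self hG,
    mul_one, ← Real.sqrt_eq_rpow, e]
  generalize Real.exp θ - Real.exp γ = d
  ring

theorem expo_eq (γ θ : ℝ) : expo γ θ
    = -(Real.cosh γ - Real.cosh θ + Real.sinh γ * (θ - γ)) / Real.sinh γ := by
  have : alpha γ θ = ((Real.cosh γ - Real.cosh θ + Real.sinh γ * (θ - γ) : ℝ) : ℂ) := by
    simp [alpha]
  rw [expo, this, Complex.ofReal_re]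

/-! ### One-term bounds -/

section Saddle

variable {n : ℕ} {γ : ℝ}

theorem exp_sub_exp_neg (γ : ℝ) : Real.exp γ - Real.exp (-γ) = 2 * Real.sinh γ := by
  rw [Real.sinh_eq]
  ring

/-- In these parameters `2b + m = m coth γ` and `y + κ = m cosh θ / sinh γ`. The exponents combine
to `m α(θ)/sinh γ = -nv/2`, and the square root supplies `√(tanh γ/(πn))`. -/
theorem saddle_factor_eq (hγ : 0 < γ) (θ b y κ : ℝ) (m : ℝ) (hm : m = n / 2)
    (hb : b = m * Real.exp (-γ) / (2 * Real.sinh γ))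
    (hy : y = m * Real.exp θ / (2 * Real.sinh γ))
    (hκ : κ = m * Real.exp (-θ) / (2 * Real.sinh γ)) :
    Real.exp (2 * b + m - y - κ) * Real.exp (m * (θ - γ)) /
      Real.sqrt (2 * Real.pi * (2 * b + m))
      = Real.sqrt (Real.tanh γ / (Real.pi * n)) * Real.exp (-(1 / 2) * n * expo γ θ) := by
  have hS : 0 < Real.sinh γ := Real.sinh_pos_iff.2 hγ
  have hC : 0 < Real.cosh γ := Real.cosh_pos γ
  have hs : 2 * b + m = m * Real.cosh γ / Real.sinh γ := by
    rw [hb, eq_div_iff hS.ne']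
    have e1 := exp_sub_exp_neg γ
    have e2 : Real.cosh γ = (Real.exp γ + Real.exp (-γ)) / 2 := Real.cosh_eq γ
    field_simp
    rw [e2]
    linear_combination (-m / 2) * e1
  have hyκ : y + κ = m * Real.cosh θ / Real.sinh γ := by
    rw [hy, hκ, Real.cosh_eq]
    field_simp
  have e1 : 2 * Real.pi * (2 * b + m) = (Real.tanh γ / (Real.pi * n))⁻¹ := by
    rw [hs, hm, Real.tanh_eq_sinh_div_cosh]
    field_simp
  rw [e1, Real.sqrt_inv, div_inv_eq_mul, ← Real.exp_add, mul_comm]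
  congr 2
  rw [show 2 * b + m - y - κ = (2 * b + m) - (y + κ) by ring, hs, hyκ, expo_eq, hm]
  field_simp

/-- With `b + m = m e^γ/(2 sinh γ)` the end point divided by `b + m` is `e^(θ-γ)`, so `γ < θ` says
that the tail begins beyond the saddle. -/
theorem ncMeasure_real_Ioi_le_gTrunc (hn : 0 < n) (hγ : 0 < γ) {θ : ℝ} (hθ : γ < θ) :
    (ncMeasure ((n : ℝ) / 2) ((n : ℝ) / 2 * Real.exp (-θ) / (2 * Real.sinh γ))).real
      (Set.Ioi ((n : ℝ) / 2 * Real.exp θ / (2 * Real.sinh γ)))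
      ≤ gTrunc n γ θ 1 * Real.exp (-(1 / 2) * n * expo γ θ) := by
  have hn1 : (1 : ℝ) ≤ n := by exact_mod_cast hn
  have hS : 0 < Real.sinh γ := Real.sinh_pos_iff.2 hγ
  set m : ℝ := (n : ℝ) / 2 with hm
  have hm0 : 0 < m := by positivity
  set b := m * Real.exp (-γ) / (2 * Real.sinh γ) with hb
  set y := m * Real.exp θ / (2 * Real.sinh γ) with hy
  set κ := m * Real.exp (-θ) / (2 * Real.sinh γ) with hκ
  have hbm : b + m = m * Real.exp γ / (2 * Real.sinh γ) := by
    rw [hb, eq_div_iff (by positivity)]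
    field_simp
    linear_combination -exp_sub_exp_neg γ
  have hlt : b + m < y := by
    rw [hbm, hy]
    have := Real.exp_lt_exp.2 hθ
    gcongr
  have hw : b * (b + m) = κ * y := by
    rw [hbm, hb, hκ, hy, Real.exp_neg, Real.exp_neg]
    field_simp
  have hratio : y / (b + m) = Real.exp (θ - γ) := by
    rw [hbm, hy, Real.exp_sub]
    field_simp
  have key := ncMeasure_real_Ioi_le_saddle (by linarith) (by positivity : 0 < κ)
    (by positivity : 0 ≤ b) hw hlt
  refine key.trans_eq ?_
  have hd : 0 < Real.exp θ - Real.exp γ := sub_pos.2 (Real.exp_lt_exp.2 hθ)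
  have e1 : (y / (b + m)) ^ (m - 1) = Real.exp (m * (θ - γ)) * (Real.exp γ / Real.exp θ) := by
    rw [hratio, ← Real.exp_mul, ← Real.exp_sub, ← Real.exp_add]
    ring_nf
  have e2 : 1 - (b + m) / y = (Real.exp θ - Real.exp γ) / Real.exp θ := by
    rw [← inv_div, hratio, Real.exp_sub]
    field_simp
  rw [e1, e2, gTrunc_one hγ, mul_right_comm (Real.sqrt _) (_ / _), ← saddle_factor_eq hγ θ b y κ m hm hb hy hκ]
  field_simp

/-- The mirror case, where the geometric factor changes sign. The condition `-γ ≤ θ` is `b ≤ y` in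
these parameters. -/
theorem ncMeasure_real_Iic_le_gTrunc (hn : 0 < n) (hγ : 0 < γ) {θ : ℝ} (hθ : θ < γ)
    (hθ' : -γ ≤ θ) :
    (ncMeasure ((n : ℝ) / 2) ((n : ℝ) / 2 * Real.exp (-θ) / (2 * Real.sinh γ))).real
      (Set.Iic ((n : ℝ) / 2 * Real.exp θ / (2 * Real.sinh γ)))
      ≤ -(gTrunc n γ θ 1 * Real.exp (-(1 / 2) * n * expo γ θ)) := by
  have hn1 : (1 : ℝ) ≤ n := by exact_mod_cast hn
  have hS : 0 < Real.sinh γ := Real.sinh_pos_iff.2 hγ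
  set m : ℝ := (n : ℝ) / 2 with hm
  have hm0 : 0 < m := by positivity
  set b := m * Real.exp (-γ) / (2 * Real.sinh γ) with hb
  set y := m * Real.exp θ / (2 * Real.sinh γ) with hy
  set κ := m * Real.exp (-θ) / (2 * Real.sinh γ) with hκ
  have hbm : b + m = m * Real.exp γ / (2 * Real.sinh γ) := by
    rw [hb, eq_div_iff (by positivity)]
    field_simp
    linear_combination -exp_sub_exp_neg γ
  have hlt : y < b + m := by
    rw [hbm, hy]
    have := Real.exp_lt_exp.2 hθ
    gcongr
  have hle : b ≤ y := by
    rw [hb, hy]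
    have := Real.exp_le_exp.2 hθ'
    gcongr
  have hw : b * (b + m) = κ * y := by
    rw [hbm, hb, hκ, hy, Real.exp_neg, Real.exp_neg]
    field_simp
  have hratio : y / (b + m) = Real.exp (θ - γ) := by
    rw [hbm, hy, Real.exp_sub]
    field_simp
  have key := ncMeasure_real_Iic_le_saddle (by linarith) (by positivity : 0 < κ)
    (by positivity : 0 < b) hw hle hlt
  refine key.trans_eq ?_
  have hd : 0 < Real.exp γ - Real.exp θ := sub_pos.2 (Real.exp_lt_exp.2 hθ)
  have e1 : (y / (b + m)) ^ m = Real.exp (m * (θ - γ)) := by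
    rw [hratio, ← Real.exp_mul]
    ring_nf
  have e2 : 1 - y / (b + m) = (Real.exp γ - Real.exp θ) / Real.exp γ := by
    rw [hratio, Real.exp_sub]
    field_simp
  have e3 : Real.exp γ / (Real.exp θ - Real.exp γ) = -(Real.exp γ / (Real.exp γ - Real.exp θ)) := by
    rw [← div_neg, neg_sub]
  rw [e1, e2, gTrunc_one hγ, mul_right_comm (Real.sqrt _) (_ / _), ← saddle_factor_eq hγ θ b y κ m hm hb hy hκ, e3,
    mul_neg, neg_neg]
  field_simp

end Saddle

/-! ### Admissible parameters, the two one-term bounds, and monotonicity in the threshold -/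

section Test

variable {n : ℕ} {σx σw : ℝ} {x : Fin n → ℝ}

theorem Admissible.pos {Ω γ : ℝ} (hΩ : 0 < Ω) (h : Admissible Ω γ) : 0 < γ := by
  have : 0 < Real.log (1 + Ω / (1 + Ω)) := Real.log_pos (by linarith [show 0 < Ω / (1 + Ω) by positivity])
  linarith [h.1]

theorem Admissible.exp_sq_lt {Ω γ : ℝ} (hΩ : 0 < Ω) (h : Admissible Ω γ) :
    Real.exp γ ^ 2 < 1 + Ω := by
  rw [← Real.exp_nat_mul, ← Real.lt_log_iff_exp_lt (by linarith)]
  push_cast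
  linarith [h.2]

theorem Admissible.lt_exp_sq {Ω γ : ℝ} (hΩ : 0 < Ω) (h : Admissible Ω γ) :
    1 + Ω / (1 + Ω) < Real.exp γ ^ 2 := by
  rw [← Real.exp_nat_mul, ← Real.log_lt_iff_lt_exp (by positivity)]
  push_cast
  linarith [h.1]

theorem two_mul_sinh_mul_exp (γ : ℝ) : 2 * Real.sinh γ * Real.exp γ = Real.exp γ ^ 2 - 1 := by
  have : Real.exp (-γ) * Real.exp γ = 1 := by rw [← Real.exp_add]; simp
  rw [← exp_sub_exp_neg]
  linear_combination -this

theorem exp_thetaMD {Ω γ : ℝ} (hΩ : 0 < Ω) (hγ : 0 < γ) :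
    Real.exp (thetaMD Ω γ) = Ω / (2 * Real.sinh γ) :=
  Real.exp_log (div_pos hΩ (mul_pos two_pos (Real.sinh_pos_iff.2 hγ)))

theorem exp_thetaFA {Ω γ : ℝ} (hΩ : 0 < Ω) (hγ : 0 < γ) :
    Real.exp (thetaFA Ω γ) = Ω / (2 * Real.sinh γ) / (1 + Ω) := by
  rw [thetaFA, Real.exp_sub, Real.exp_log (by positivity : 0 < 1 + Ω)]
  exact congrArg (· / (1 + Ω)) (exp_thetaMD hΩ hγ)

theorem Admissible.lt_thetaMD {Ω γ : ℝ} (hΩ : 0 < Ω) (h : Admissible Ω γ) : γ < thetaMD Ω γ := by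
  have hS := Real.sinh_pos_iff.2 (h.pos hΩ)
  rw [← Real.exp_lt_exp, exp_thetaMD hΩ (h.pos hΩ), lt_div_iff₀ (by positivity)]
  linarith [two_mul_sinh_mul_exp γ, h.exp_sq_lt hΩ]

theorem Admissible.thetaFA_lt {Ω γ : ℝ} (hΩ : 0 < Ω) (h : Admissible Ω γ) : thetaFA Ω γ < γ := by
  have hS := Real.sinh_pos_iff.2 (h.pos hΩ)
  rw [← Real.exp_lt_exp, exp_thetaFA hΩ (h.pos hΩ), div_right_comm, div_lt_iff₀ (by positivity)]
  linarith [two_mul_sinh_mul_exp γ, h.lt_exp_sq hΩ]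

/-- This too reduces to `e^(2γ) ≤ 1 + Ω`: the upper end of the range, which gives `γ < θ_MD`, also
serves the false-alarm bound. -/
theorem Admissible.neg_le_thetaFA {Ω γ : ℝ} (hΩ : 0 < Ω) (h : Admissible Ω γ) :
    -γ ≤ thetaFA Ω γ := by
  have hS := Real.sinh_pos_iff.2 (h.pos hΩ)
  have hE := Real.exp_pos γ
  rw [← Real.exp_le_exp, exp_thetaFA hΩ (h.pos hΩ), Real.exp_neg, div_div,
    le_div_iff₀ (by positivity)]
  have e : (Real.exp γ)⁻¹ * (2 * Real.sinh γ * (1 + Ω))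
      = (Real.exp γ ^ 2 - 1) * (1 + Ω) / Real.exp γ ^ 2 := by
    rw [← two_mul_sinh_mul_exp]
    field_simp
  rw [e, div_le_iff₀ (by positivity)]
  linarith [h.exp_sq_lt hΩ]

theorem distThreshold_threshold {Ω γ : ℝ} (hΩ : 0 < Ω) (hγ : 0 < γ) :
    distThreshold n Ω (threshold Ω γ) = (n : ℝ) / 2 * Real.exp (thetaMD Ω γ) / (2 * Real.sinh γ) := by
  have hS := Real.sinh_pos_iff.2 hγ
  rw [exp_thetaMD hΩ hγ, distThreshold, threshold]
  field_simp
  ring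

theorem distThreshold_strictAnti (hn : 0 < n) {Ω lam lam' : ℝ} (hΩ : 0 < Ω) (h : lam < lam') :
    distThreshold n Ω lam' < distThreshold n Ω lam := by
  have hn0 : (0 : ℝ) < n := by exact_mod_cast hn
  exact mul_lt_mul_of_pos_right (by linarith) (by positivity)

/-- One-term bound on the missed-detection probability. -/
theorem pMD_le_pMDTrunc (hn : 0 < n) (hσx : 0 < σx) (hσw : 0 < σw)
    (hx : ∑ i, x i ^ 2 = n * σx ^ 2) {γ : ℝ} (h : Admissible (snr σx σw) γ) :
    pMD σx σw x (threshold (snr σx σw) γ) ≤ pMDTrunc n (snr σx σw) 1 γ := by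
  have hΩ := snr_pos hσx hσw
  have hγ := h.pos hΩ
  have hS := Real.sinh_pos_iff.2 hγ
  have hθ := h.lt_thetaMD hΩ
  have hstep : step (Real.sign (γ - thetaMD (snr σx σw) γ)) = 0 := by
    rw [Real.sign_of_neg (by linarith), step, if_neg (by norm_num)]
  have hκ : (n : ℝ) / (2 * snr σx σw)
      = (n : ℝ) / 2 * Real.exp (-thetaMD (snr σx σw) γ) / (2 * Real.sinh γ) := by
    rw [Real.exp_neg, exp_thetaMD hΩ hγ]
    field_simp
  rw [pMD_eq hn hσx hσw hx, pMDTrunc, hstep, zero_add, distThreshold_threshold hΩ hγ, hκ]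
  exact ncMeasure_real_Ioi_le_gTrunc hn hγ hθ

/-- One-term bound on the false-alarm probability. -/
theorem pFA_le_pFATrunc (hn : 0 < n) (hσx : 0 < σx) (hσw : 0 < σw)
    (hx : ∑ i, x i ^ 2 = n * σx ^ 2) {γ : ℝ} (h : Admissible (snr σx σw) γ) :
    pFA σx σw x (threshold (snr σx σw) γ) ≤ pFATrunc n (snr σx σw) 1 γ := by
  have hΩ := snr_pos hσx hσw
  have hγ := h.pos hΩ
  have hS := Real.sinh_pos_iff.2 hγ
  have hθ := h.thetaFA_lt hΩ
  have hstep : step (-Real.sign (γ - thetaFA (snr σx σw) γ)) = 0 := by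
    rw [Real.sign_of_pos (by linarith), step, if_neg (by norm_num)]
  have hκ : (n : ℝ) * (1 + snr σx σw) / (2 * snr σx σw)
      = (n : ℝ) / 2 * Real.exp (-thetaFA (snr σx σw) γ) / (2 * Real.sinh γ) := by
    rw [Real.exp_neg, exp_thetaFA hΩ hγ]
    field_simp
  have hy : distThreshold n (snr σx σw) (threshold (snr σx σw) γ) / (1 + snr σx σw)
      = (n : ℝ) / 2 * Real.exp (thetaFA (snr σx σw) γ) / (2 * Real.sinh γ) := by
    rw [distThreshold_threshold hΩ hγ, exp_thetaFA hΩ hγ, exp_thetaMD hΩ hγ]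
    field_simp
  rw [pFA_eq hn hσx hσw hx, pFATrunc, hstep, zero_sub, hy, hκ]
  exact ncMeasure_real_Iic_le_gTrunc hn hγ hθ (h.neg_le_thetaFA hΩ)

/-- Strictness comes from positivity of the density on `(0, ∞)`, so the larger of the two distance
cuts must be positive. -/
theorem pMD_lt_pMD (hn : 0 < n) (hσx : 0 < σx) (hσw : 0 < σw)
    (hx : ∑ i, x i ^ 2 = n * σx ^ 2) {lam lam' : ℝ} (h : lam < lam')
    (hpos : 0 < distThreshold n (snr σx σw) lam) : pMD σx σw x lam < pMD σx σw x lam' := by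
  have hΩ := snr_pos hσx hσw
  have hn0 : (0 : ℝ) < n := by exact_mod_cast hn
  have hm : (0 : ℝ) < (n : ℝ) / 2 := by positivity
  have hκ : 0 ≤ (n : ℝ) / (2 * snr σx σw) := by positivity
  have hτ := distThreshold_strictAnti hn hΩ h
  have := isProbabilityMeasure_ncMeasure hm hκ
  have h1 := ncMeasure_real_Ioc_pos hm hκ hτ hpos
  rw [pMD_eq hn hσx hσw hx, pMD_eq hn hσx hσw hx, ← Set.Ioc_union_Ioi_eq_Ioi hτ.le,
    measureReal_union ?_ measurableSet_Ioi]
  · linarith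
  · exact Set.disjoint_left.2 fun y hy hy' => not_lt.2 hy.2 hy'

theorem pMD_le_pMD (hn : 0 < n) (hσx : 0 < σx) (hσw : 0 < σw)
    (hx : ∑ i, x i ^ 2 = n * σx ^ 2) {lam lam' : ℝ} (h : lam ≤ lam') :
    pMD σx σw x lam ≤ pMD σx σw x lam' := by
  have hΩ := snr_pos hσx hσw
  have hn0 : (0 : ℝ) < n := by exact_mod_cast hn
  have := isProbabilityMeasure_ncMeasure (by positivity : (0 : ℝ) < (n : ℝ) / 2)
    (by positivity : 0 ≤ (n : ℝ) / (2 * snr σx σw))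
  rcases h.eq_or_lt with rfl | h
  · exact le_rfl
  · rw [pMD_eq hn hσx hσw hx, pMD_eq hn hσx hσw hx]
    exact measureReal_mono (Set.Ioi_subset_Ioi (distThreshold_strictAnti hn hΩ h).le)

theorem pFA_lt_pFA (hn : 0 < n) (hσx : 0 < σx) (hσw : 0 < σw)
    (hx : ∑ i, x i ^ 2 = n * σx ^ 2) {lam lam' : ℝ} (h : lam < lam')
    (hpos : 0 < distThreshold n (snr σx σw) lam) : pFA σx σw x lam' < pFA σx σw x lam := by
  have hΩ := snr_pos hσx hσw
  have hn0 : (0 : ℝ) < n := by exact_mod_cast hn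
  have hm : (0 : ℝ) < (n : ℝ) / 2 := by positivity
  have hκ : 0 ≤ (n : ℝ) * (1 + snr σx σw) / (2 * snr σx σw) := by positivity
  have hτ := div_lt_div_of_pos_right (distThreshold_strictAnti hn hΩ h)
    (by positivity : 0 < 1 + snr σx σw)
  have := isProbabilityMeasure_ncMeasure hm hκ
  have h1 := ncMeasure_real_Ioc_pos hm hκ hτ (by positivity)
  rw [pFA_eq hn hσx hσw hx, pFA_eq hn hσx hσw hx, ← Set.Iic_union_Ioc_eq_Iic hτ.le,
    measureReal_union ?_ measurableSet_Ioc]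
  · linarith
  · exact Set.disjoint_left.2 fun y hy hy' => not_lt.2 hy hy'.1

theorem pFA_le_pFA (hn : 0 < n) (hσx : 0 < σx) (hσw : 0 < σw)
    (hx : ∑ i, x i ^ 2 = n * σx ^ 2) {lam lam' : ℝ} (h : lam ≤ lam') :
    pFA σx σw x lam' ≤ pFA σx σw x lam := by
  have hΩ := snr_pos hσx hσw
  have hn0 : (0 : ℝ) < n := by exact_mod_cast hn
  have := isProbabilityMeasure_ncMeasure (by positivity : (0 : ℝ) < (n : ℝ) / 2)
    (by positivity : 0 ≤ (n : ℝ) * (1 + snr σx σw) / (2 * snr σx σw))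
  rcases h.eq_or_lt with rfl | h
  · exact le_rfl
  · rw [pFA_eq hn hσx hσw hx, pFA_eq hn hσx hσw hx]
    exact measureReal_mono (Set.Iic_subset_Iic.2 (div_le_div_of_nonneg_right
      (distThreshold_strictAnti hn hΩ h).le (by positivity)))

theorem pFA_pos (hn : 0 < n) (hσx : 0 < σx) (hσw : 0 < σw)
    (hx : ∑ i, x i ^ 2 = n * σx ^ 2) {lam : ℝ} (hpos : 0 < distThreshold n (snr σx σw) lam) :
    0 < pFA σx σw x lam :=
  lt_of_le_of_lt measureReal_nonneg (pFA_lt_pFA hn hσx hσw hx (lt_add_one lam) hpos)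

theorem pMD_eq_one (hn : 0 < n) (hσx : 0 < σx) (hσw : 0 < σw)
    (hx : ∑ i, x i ^ 2 = n * σx ^ 2) {lam : ℝ} (h : distThreshold n (snr σx σw) lam ≤ 0) :
    pMD σx σw x lam = 1 := by
  have hΩ := snr_pos hσx hσw
  have hn0 : (0 : ℝ) < n := by exact_mod_cast hn
  have hm : (0 : ℝ) < (n : ℝ) / 2 := by positivity
  have hκ : 0 ≤ (n : ℝ) / (2 * snr σx σw) := by positivity
  have := isProbabilityMeasure_ncMeasure hm hκ
  rw [pMD_eq hn hσx hσw hx, ncMeasure_real hm hκ measurableSet_Ioi,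
    Set.inter_eq_right.2 (Set.Ioi_subset_Ioi h), ← Set.univ_inter (Set.Ioi (0 : ℝ)),
    ← ncMeasure_real hm hκ MeasurableSet.univ, probReal_univ]

theorem rate_le_rate {p q : ℝ} (hp : 0 < p) (hpq : p ≤ q) : rate n q ≤ rate n p := by
  have h := Real.logb_le_logb_of_le one_lt_two hp hpq
  have hn0 : 0 ≤ 1 / (n : ℝ) := by positivity
  rw [rate, rate, neg_mul, neg_mul, neg_le_neg_iff]
  exact mul_le_mul_of_nonneg_left h hn0

theorem eq_of_rate_eq (hn : 0 < n) {p q : ℝ} (hp : 0 < p) (hq : 0 < q) (h : rate n p = rate n q) :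
    p = q := by
  have hn0 : (0 : ℝ) < n := by exact_mod_cast hn
  have hne : -(1 / (n : ℝ)) ≠ 0 := neg_ne_zero.2 (by positivity)
  exact Real.logb_injOn_pos one_lt_two hp hq (mul_left_cancel₀ hne h)

end Test

end AWGN

/-! ### Assembly: the one-term bounds and their consequences for rate and error probability -/

theorem theorem8 (n : ℕ) (hn : 0 < n) (σx σw : ℝ) (hσx : 0 < σx) (hσw : 0 < σw)
    (x : Fin n → ℝ) (hx : ∑ i, x i ^ 2 = n * σx ^ 2) :
    (∀ γ : ℝ, AWGN.Admissible (AWGN.snr σx σw) γ →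
      AWGN.pMD σx σw x (AWGN.threshold (AWGN.snr σx σw) γ)
          ≤ AWGN.pMDTrunc n (AWGN.snr σx σw) 1 γ ∧
      AWGN.pFA σx σw x (AWGN.threshold (AWGN.snr σx σw) γ)
          ≤ AWGN.pFATrunc n (AWGN.snr σx σw) 1 γ) ∧
    (∀ Pe : ℝ, 0 < Pe → Pe < 1 → ∀ R R₁ : ℝ, AWGN.IsRateBound σx σw x Pe R →
      AWGN.IsRateTrunc n (AWGN.snr σx σw) 1 Pe R₁ → R₁ ≤ R) ∧
    (∀ R : ℝ, 0 < R → ∀ P P₁ : ℝ, AWGN.IsErrorBound σx σw x R P →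
      AWGN.IsErrorTrunc n (AWGN.snr σx σw) 1 R P₁ → P ≤ P₁) := by
  have hΩ := AWGN.snr_pos hσx hσw
  have hn0 : (0 : ℝ) < n := by exact_mod_cast hn
  have hMD := fun γ (h : AWGN.Admissible (AWGN.snr σx σw) γ) =>
    AWGN.pMD_le_pMDTrunc hn hσx hσw hx h
  have hFA := fun γ (h : AWGN.Admissible (AWGN.snr σx σw) γ) =>
    AWGN.pFA_le_pFATrunc hn hσx hσw hx h
  have hτ : ∀ γ, AWGN.Admissible (AWGN.snr σx σw) γ →
      0 < AWGN.distThreshold n (AWGN.snr σx σw) (AWGN.threshold (AWGN.snr σx σw) γ) := by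
    intro γ h
    have hS := Real.sinh_pos_iff.2 (h.pos hΩ)
    rw [AWGN.distThreshold_threshold hΩ (h.pos hΩ)]
    positivity
  refine ⟨fun γ h => ⟨hMD γ h, hFA γ h⟩, ?_, ?_⟩
  · rintro Pe - hPe1 R R₁ ⟨lam, hlam, rfl⟩ ⟨γ, h, hγ, rfl⟩
    have hle : AWGN.threshold (AWGN.snr σx σw) γ ≤ lam := by
      by_contra! hlt
      have h1 := AWGN.pMD_lt_pMD hn hσx hσw hx hlt
        ((hτ γ h).trans (AWGN.distThreshold_strictAnti hn hΩ hlt))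
      linarith [hMD γ h]
    -- `Pe < 1` excludes a nonpositive cut. This makes the false-alarm probability positive, as
    -- monotonicity of the logarithm requires.
    have hpos : 0 < AWGN.distThreshold n (AWGN.snr σx σw) lam := by
      by_contra! hneg
      linarith [AWGN.pMD_eq_one hn hσx hσw hx hneg]
    exact AWGN.rate_le_rate (AWGN.pFA_pos hn hσx hσw hx hpos)
      ((AWGN.pFA_le_pFA hn hσx hσw hx hle).trans (hFA γ h))
  · rintro R hR P P₁ ⟨lam, hlam, rfl⟩ ⟨γ, h, hγ, rfl⟩
    have hp : 0 < AWGN.pFA σx σw x lam := by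
      refine lt_of_le_of_ne measureReal_nonneg fun h0 => ?_
      -- Since `Real.logb 2 0 = 0`, a vanishing false-alarm probability would have rate `0`; `R > 0`
      -- rules this out.
      rw [← h0, AWGN.rate, Real.logb_zero, mul_zero] at hlam
      linarith
    have hq := (AWGN.pFA_pos hn hσx hσw hx (hτ γ h)).trans_le (hFA γ h)
    have heq := AWGN.eq_of_rate_eq hn hp hq (hlam.trans hγ.symm)
    have hle : lam ≤ AWGN.threshold (AWGN.snr σx σw) γ := by
      by_contra! hlt
      linarith [AWGN.pFA_lt_pFA hn hσx hσw hx hlt (hτ γ h), hFA γ h]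
    exact (AWGN.pMD_le_pMD hn hσx hσw hx hle).trans (hMD γ h)
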